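/- \textbf{Theorem.} Let $\Bbbk$ be a field with $\operatorname{char}\Bbbk\neq 2$. Let $\mathbf{G}$ be an algebraic supergroup over $\Bbbk$, i.e. an affine supergroup scheme represented by a finitely generated supercommutative Hopf superalgebra $A=\mathcal{O}(\mathbf{G})$ with antipode $S_A$, and let $\mathbf{N}$ be a finite normal closed super-subgroup of $\mathbf{G}$; that is, there is a surjective homomorphism of Hopf superalgebras $A\twoheadrightarrow B=\mathcal{O}(\mathbf{N})$, $a\mapsto \overline{a}$, with $\dim_\Bbbk B<\infty$, such that $\mathbf{N}(R)$ is a normal subgroup of $\mathbf{G}(R)$ for every commutative superalgebra $R$. Give $B^*$ the convolution product $(f*\phi)(b)=\sum(-1)^{|b_{(1)}||\phi|}f(b_{(1)})\phi(b_{(2)})$ and the counit $f\mapsto f(1_B)$, and put \[ \textstyle\int_{L}=\{\phi\in B^*: f*\phi=f(1_B)\phi\ \ \forall f\in B^*\},\qquad \int_{R}=\{\phi\in B^*: \phi*f=f(1_B)\phi\ \ \forall f\in B^*\}, \] the spaces of left and of right integrals in $B^*$ (equivalently, left and right cointegrals on $B$). The supergroup $\mathbf{N}$ is called \emph{unimodular}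 if $\int_L=\int_R\neq 0$. A \emph{group-like} element of a Hopf superalgebra $H$ is an even element $g\neq 0$ with $\Delta(g)=g\otimes g$; the group-like elements of $\mathcal{O}(\mathbf{G})$ are identified with the characters $\mathbf{G}\to\mathbf{G}_m$, and the restriction $\chi|_{\mathbf{N}}$ of a character $\chi$ is then $\overline{\chi}\in B$. Then: \begin{enumerate} \item $\dim_\Bbbk\int_L=1$. \item The coadjoint coaction $a\mapsto\sum(-1)^{|a_{(2)}||a_{(3)}|}a_{(1)}S_A(a_{(3)})\otimes a_{(2)}$ of $A$ induces a linear map $\operatorname{coad}_B:B\to A\otimes B$, $\overline{a}\mapsto\sum(-1)^{|a_{(2)}||a_{(3)}|}a_{(1)}S_A(a_{(3)})\otimes \overline{a_{(2)}}$ (the action of $\mathbf{G}$ on $\mathbf{N}$ by conjugation). Let $\operatorname{coad}_B^*:B^*\to B^*\otimes A$ be the dual right $A$-supercomodule structure. There is a unique group-like $\chi\in A$, i.e. a unique character of $\mathbf{G}$, with $\operatorname{coad}_B^*(\phi)=\phi\otimes\chi$ for all $\phi\in\int_L$. \item There is a unique group-like $\alpha\in B$ (the distinguished group-like element of $B^*$)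 with $\phi*f=f(\alpha)\,\phi$ for all $\phi\in\int_L$ and $f\in B^*$. \item $\chi|_{\mathbf{N}}=\alpha^{-1}$. \item $\chi|_{\mathbf{N}}$ is trivial if and only if $\mathbf{N}$ is unimodular. In particular, $\mathbf{N}$ is unimodular if $\chi$ is trivial. \end{enumerate} -/

import Mathlib

open scoped TensorProduct

universe u v

noncomputable section

namespace SuperHopf

/-- A superalgebra over `k`: an associative unital `k`-algebra with a `ℤ/2`-grading
`A = A₀ ⊕ A₁` such that `1 ∈ A₀` and `Aᵢ Aⱼ ⊆ Aᵢ₊ⱼ`. -/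
class Superalgebra (k : Type u) (A : Type v) [Field k] [Ring A] [Algebra k A] where
  /-- The homogeneous components. -/
  grading : ZMod 2 → Submodule k A
  /-- They form a (direct sum, multiplicative) grading. -/
  [gradedAlgebra : GradedAlgebra grading]

attribute [instance, reducible] Superalgebra.gradedAlgebra

section Superspace

variable (k : Type u) (A : Type v) [Field k] [Ring A] [Algebra k A] [Superalgebra k A]

/-- The homogeneous component `Aᵢ` of a superalgebra. -/
abbrev gr (i : ZMod 2) : Submodule k A := Superalgebra.grading i

/-- The projection `A → Aᵢ ⊆ A` onto the component of parity `i`. -/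
def proj (i : ZMod 2) : A →ₗ[k] A := GradedAlgebra.proj (gr k A) i

/-- The parity automorphism `a ↦ (-1)^|a| a`. -/
def parity : A →ₗ[k] A := proj k A 0 - proj k A 1

/-- The sign map `a ⊗ b ↦ (-1)^(|a||b|) a ⊗ b`. -/
def signTwist : A ⊗[k] A →ₗ[k] A ⊗[k] A :=
  TensorProduct.map (proj k A 0) LinearMap.id + TensorProduct.map (proj k A 1) (parity k A)

/-- The projection of `A ⊗ A` onto its component of parity `i`,
`(A ⊗ A)ᵢ = ⨁_{a + b = i} A_a ⊗ A_b`. -/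
def tensorProj (i : ZMod 2) : A ⊗[k] A →ₗ[k] A ⊗[k] A :=
  ∑ j : ZMod 2, TensorProduct.map (proj k A j) (proj k A (i - j))

variable {k A}

theorem proj_of_mem {i : ZMod 2} {a : A} (ha : a ∈ gr k A i) : proj k A i a = a := by
  rw [proj, GradedAlgebra.proj_apply, DirectSum.decompose_of_mem_same _ ha]

theorem proj_of_mem_ne {i j : ZMod 2} {a : A} (ha : a ∈ gr k A i) (hij : i ≠ j) :
    proj k A j a = 0 := by
  rw [proj, GradedAlgebra.proj_apply, DirectSum.decompose_of_mem_ne _ ha hij]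

theorem signTwist_tmul_of_mem {i j : ZMod 2} {a b : A} (ha : a ∈ gr k A i) (hb : b ∈ gr k A j) :
    signTwist k A (a ⊗ₜ b) = (-1 : ℤˣ) ^ (i * j) • (a ⊗ₜ[k] b) := by
  have h01 : (0 : ZMod 2) ≠ 1 := by decide
  have h10 : (1 : ZMod 2) ≠ 0 := by decide
  have key : ∀ i : ZMod 2, i = 0 ∨ i = 1 := by decide
  rcases key i with rfl | rfl <;> rcases key j with rfl | rfl
  · have := proj_of_mem (i := 0) ha
    have := proj_of_mem_ne (i := 0) ha h01
    simp_all [signTwist]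
  · have := proj_of_mem (i := 0) ha
    have := proj_of_mem_ne (i := 0) ha h01
    simp_all [signTwist]
  · have := proj_of_mem (i := 1) ha
    have := proj_of_mem_ne (i := 1) ha h10
    have := proj_of_mem (i := 0) hb
    have := proj_of_mem_ne (i := 0) hb h01
    simp_all [signTwist, parity]
  · have := proj_of_mem (i := 1) ha
    have := proj_of_mem_ne (i := 1) ha h10
    have := proj_of_mem (i := 1) hb
    have := proj_of_mem_ne (i := 1) hb h10
    simp_all [signTwist, parity, TensorProduct.tmul_neg]

end Superspace

/-- Supercommutativity: `a b = (-1)^(|a||b|) b a` for homogeneous `a`, `b`. -/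
def IsSupercommutative (k : Type u) (A : Type v) [Field k] [Ring A] [Algebra k A]
    [Superalgebra k A] : Prop :=
  ∀ (i j : ZMod 2) (a b : A), a ∈ gr k A i → b ∈ gr k A j →
    a * b = (-1 : ℤˣ) ^ (i * j) • (b * a)

/-- A Hopf superalgebra over `k`: a Hopf algebra object in the symmetric monoidal category of
superspaces. The comultiplication is multiplicative for the graded tensor product, in which
`(a ⊗ b)(a' ⊗ b') = (-1)^(|b||a'|) a a' ⊗ b b'`, and all structure maps preserve parity. -/
class HopfSuperalgebra (k : Type u) (A : Type v) [Field k] [Ring A] [Algebra k A] extends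
    Superalgebra k A, Coalgebra k A where
  comul_proj : ∀ i : ZMod 2, comul ∘ₗ proj k A i = tensorProj k A i ∘ₗ comul
  counit_odd : ∀ a ∈ gr k A 1, counit a = 0
  comul_one : comul (1 : A) = 1 ⊗ₜ[k] 1
  comul_mul : ∀ a b : A,
    GradedTensorProduct.of k (gr k A) (gr k A) (comul (a * b)) =
      GradedTensorProduct.of k (gr k A) (gr k A) (comul a) *
        GradedTensorProduct.of k (gr k A) (gr k A) (comul b)
  counit_one : counit (1 : A) = 1
  counit_mul : ∀ a b : A, counit (a * b) = counit a * counit b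
  /-- The antipode. -/
  antipode : A →ₗ[k] A
  antipode_mem : ∀ (i : ZMod 2), ∀ a ∈ gr k A i, antipode a ∈ gr k A i
  mul_antipode_rTensor_comul :
    LinearMap.mul' k A ∘ₗ antipode.rTensor A ∘ₗ comul = Algebra.linearMap k A ∘ₗ counit
  mul_antipode_lTensor_comul :
    LinearMap.mul' k A ∘ₗ antipode.lTensor A ∘ₗ comul = Algebra.linearMap k A ∘ₗ counit

open HopfSuperalgebra (antipode)
open CoalgebraStruct (comul counit)

section

variable {k : Type u} [Field k]
variable {A : Type v} [Ring A] [Algebra k A]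
variable {B : Type v} [Ring B] [Algebra k B]

/-- A parity preserving algebra homomorphism, i.e. a homomorphism of superalgebras. -/
def IsSuperHom [Superalgebra k A] [Superalgebra k B] (f : A →ₐ[k] B) : Prop :=
  ∀ (i : ZMod 2), ∀ a ∈ gr k A i, f a ∈ gr k B i

/-- A homomorphism of Hopf superalgebras. -/
structure IsHopfSuperHom [HopfSuperalgebra k A] [HopfSuperalgebra k B] (f : A →ₐ[k] B) :
    Prop where
  isSuperHom : IsSuperHom f
  map_comul : ∀ a : A, comul (f a) =
    TensorProduct.map f.toLinearMap f.toLinearMap (comul (R := k) a)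
  map_counit : ∀ a : A, counit (R := k) (f a) = counit (R := k) a
  map_antipode : ∀ a : A, f (antipode (k := k) a) = antipode (k := k) (f a)

/-- The product `(g h)(a) = ∑ g(a₁) h(a₂)`. On homomorphisms of superalgebras `A → R` with `R`
supercommutative it is the group law of `G(R)`, where `G` is the supergroup represented by `A`;
the inverse of `g` in `G(R)` is `g ∘ S`. -/
def pointMul [HopfSuperalgebra k A] {R : Type v} [Ring R] [Algebra k R] (g h : A →ₗ[k] R) :
    A →ₗ[k] R :=
  LinearMap.mul' k R ∘ₗ TensorProduct.map g h ∘ₗ comul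

/-- The closed super-subgroup `N` of `G` given by a surjection `π : A = O(G) → B = O(N)` of
commutative Hopf superalgebras is normal: for every commutative superalgebra `R`, every
`g ∈ G(R)` and every `n ∈ N(R)`, the point `g n g⁻¹` of `G(R)` lies in `N(R)`, that is,
factors through `π`. -/
def IsNormal [HopfSuperalgebra k A] [HopfSuperalgebra k B] (π : A →ₐ[k] B) : Prop :=
  ∀ (R : Type v) [Ring R] [Algebra k R] [Superalgebra k R], IsSupercommutative k R →
    ∀ (g : A →ₐ[k] R) (n : B →ₐ[k] R), IsSuperHom g → IsSuperHom n →
      ∃ n' : B →ₐ[k] R, IsSuperHom n' ∧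
        (n'.comp π).toLinearMap =
          pointMul (pointMul g.toLinearMap (n.comp π).toLinearMap)
            (g.toLinearMap ∘ₗ antipode (k := k))

variable (k) in
/-- Group-like elements of a Hopf superalgebra: non-zero, even, with `Δ(g) = g ⊗ g`. For
`A = O(G)` they are the characters of `G`; the trivial character is `1`. -/
def IsGroupLike [HopfSuperalgebra k A] (g : A) : Prop :=
  g ≠ 0 ∧ g ∈ gr k A 0 ∧ comul (R := k) g = g ⊗ₜ[k] g

/-- The product of the dual superalgebra:
`(f * φ)(h) = ∑ (-1)^(|h₁||φ|) f(h₁) φ(h₂)`. As `φ(h₂)` vanishes unless `|h₂| = |φ|`, the sign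
is `(-1)^(|h₁||h₂|)`. -/
def dualMul [HopfSuperalgebra k B] (f φ : Module.Dual k B) : Module.Dual k B :=
  LinearMap.mul' k k ∘ₗ TensorProduct.map f φ ∘ₗ signTwist k B ∘ₗ comul

variable (k B) in
/-- Left cointegrals on `B`, that is, left integrals in `B^*` (whose counit is `f ↦ f(1)`):
functionals `φ` with `f * φ = f(1) φ` for all `f`. -/
def leftIntegrals [HopfSuperalgebra k B] : Submodule k (Module.Dual k B) where
  carrier := {φ | ∀ f : Module.Dual k B, dualMul f φ = f 1 • φ}
  add_mem' {a b} ha hb f := by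
    have h : dualMul f (a + b) = dualMul f a + dualMul f b := by
      simp [dualMul, TensorProduct.map_add_right, LinearMap.add_comp, LinearMap.comp_add]
    rw [h, ha f, hb f, smul_add]
  zero_mem' f := by simp [dualMul]
  smul_mem' c a ha f := by
    have h : dualMul f (c • a) = c • dualMul f a := by
      simp [dualMul, TensorProduct.map_smul_right, LinearMap.smul_comp, LinearMap.comp_smul]
    rw [h, ha f, smul_comm]

variable (k B) in
/-- Right cointegrals on `B`: functionals `φ` with `φ * f = f(1) φ` for all `f`. -/
def rightIntegrals [HopfSuperalgebra k B] : Submodule k (Module.Dual k B) where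
  carrier := {φ | ∀ f : Module.Dual k B, dualMul φ f = f 1 • φ}
  add_mem' {a b} ha hb f := by
    have h : dualMul (a + b) f = dualMul a f + dualMul b f := by
      simp [dualMul, TensorProduct.map_add_left, LinearMap.add_comp, LinearMap.comp_add]
    rw [h, ha f, hb f, smul_add]
  zero_mem' f := by simp [dualMul]
  smul_mem' c a ha f := by
    have h : dualMul (c • a) f = c • dualMul a f := by
      simp [dualMul, TensorProduct.map_smul_left, LinearMap.smul_comp, LinearMap.comp_smul]
    rw [h, ha f, smul_comm]

variable (k B) in
/-- The supergroup represented by `B` is unimodular: left and right cointegrals on `B` coincide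
and are not all zero. -/
def IsUnimodular [HopfSuperalgebra k B] : Prop :=
  leftIntegrals k B = rightIntegrals k B ∧ leftIntegrals k B ≠ ⊥

/-- `d ∈ B` is a distinguished group-like element for `B^*` (with `B^** = B`):
`φ * f = f(d) φ` for all left integrals `φ` in `B^*` and all `f ∈ B^*`. -/
def IsDistinguishedGroupLike [HopfSuperalgebra k B] (d : B) : Prop :=
  IsGroupLike k d ∧
    ∀ φ ∈ leftIntegrals k B, ∀ f : Module.Dual k B, dualMul φ f = f d • φ

variable (k A) in
/-- The left coadjoint coaction `a ↦ ∑ (-1)^(|a₂||a₃|) a₁ S(a₃) ⊗ a₂` of `A` on itself. -/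
def coad [HopfSuperalgebra k A] : A →ₗ[k] A ⊗[k] A :=
  (LinearMap.mul' k A).rTensor A ∘ₗ
    (TensorProduct.assoc k A A A).symm.toLinearMap ∘ₗ
    ((antipode (k := k) (A := A)).rTensor A ∘ₗ (TensorProduct.comm k A A).toLinearMap ∘ₗ
      signTwist k A ∘ₗ comul).lTensor A ∘ₗ
    comul

/-- `δ : B → A ⊗ B` is the coaction induced on the quotient `π : A → B` by the coadjoint
coaction. It is unique when `π` is surjective; it corresponds to the action of `G` on the normal
super-subgroup `N` by conjugation. -/
def IsInducedCoad [HopfSuperalgebra k A] (π : A →ₐ[k] B) (δ : B →ₗ[k] A ⊗[k] B) : Prop :=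
  δ ∘ₗ π.toLinearMap = π.toLinearMap.lTensor A ∘ₗ coad k A

/-- The right `A`-supercomodule structure `f ↦ ∑ f₀ ⊗ f₁` on `B^*` dual to a left
`A`-supercomodule structure `b ↦ ∑ b₋₁ ⊗ b₀` on a finite-dimensional `B`:
`∑ f₀(b) f₁ = ∑ (-1)^|b₋₁| b₋₁ f(b₀)`. -/
def dualCoaction [Superalgebra k A] [FiniteDimensional k B] (δ : B →ₗ[k] A ⊗[k] B)
    (f : Module.Dual k B) : Module.Dual k B ⊗[k] A :=
  (dualTensorHomEquiv k B A).symm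
    (parity k A ∘ₗ (TensorProduct.rid k A).toLinearMap ∘ₗ f.lTensor A ∘ₗ δ)

/-- `χ` is the character by which `G` acts on the left integrals in `O(N)^*` through the
coaction dual to `δ`: `χ` is group-like, and `φ ↦ φ ⊗ χ` for every left integral `φ`. -/
def IsIntegralCharacter [HopfSuperalgebra k A] [HopfSuperalgebra k B] [FiniteDimensional k B]
    (δ : B →ₗ[k] A ⊗[k] B) (χ : A) : Prop :=
  IsGroupLike k χ ∧ ∀ φ ∈ leftIntegrals k B, dualCoaction δ φ = φ ⊗ₜ[k] χ

end

end SuperHopf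

end

open SuperHopf

/-! Everything rests on one fact: left integrals on `B` form a line. A finite-dimensional
supercommutative `B` is Artinian, and a socle argument produces an element that spans the trivial
character under multiplication; it can be taken homogeneous (`exists_integral`). For such a `Λ` the
map `g ↦ ∑ Λ₁ g(Λ₂)` from `B^*` to `B` is bijective (`exists_frobenius`). A left integral `f` is
sent to `f(Λ) • 1`, so the preimage `φ` of `1` spans the left integrals (`exists_leftIntegral`).

Each symmetry of the line then acts by a scalar. Right convolution by `f` preserves left integrals,
and the scalar is `f(d)` for a group-like `d` (`exists_groupLike`). Parity preserves them, so `φ` is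
homogeneous of some parity `q`. Conjugation by `G` preserves them too, since `n (g φ g⁻¹) = g (g⁻¹ n
g) φ g⁻¹` and `g⁻¹ n g` again lies in `N`; the scalar is now an element `χ` of `A`, and conjugating
by a product of points makes it group-like (`exists_character`). On `N` left invariance turns `g φ
g⁻¹` into `φ g⁻¹`, so `π χ = S(d)` (`map_character_eq`). Unimodularity amounts to `d = 1`.

Points are treated as elements of convolution algebras of linear maps into a superalgebra, where the
identities above are literal products. Normality is used only at universal points, with values in `A
⊗ B` and `B ⊗ A`; this requires the super tensor product to be a supercommutative superalgebra, and
characteristic different from 2 lets its grading be defined by the parity involution. -/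

noncomputable section

namespace SuperHopf

open SuperHopf.HopfSuperalgebra (antipode)
open CoalgebraStruct (comul counit)

/-! ### Gradings by `ℤ/2` through the parity automorphism -/

section Parity

variable {k : Type u} [Field k]

variable (k) in
/-- The sign `(-1)^i` in `k`. -/
def sgn (i : ZMod 2) : k := if i = 0 then 1 else -1

@[simp] theorem sgn_zero : sgn k 0 = 1 := rfl

@[simp] theorem sgn_one : sgn k 1 = -1 := rfl

theorem zmod_two_cases (i : ZMod 2) : i = 0 ∨ i = 1 := by
  revert i; decide

theorem sgn_add (i j : ZMod 2) : sgn k (i + j) = sgn k i * sgn k j := by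
  have h11 : (1 : ZMod 2) + 1 = 0 := by decide
  rcases zmod_two_cases i with rfl | rfl <;> rcases zmod_two_cases j with rfl | rfl <;> simp [h11]

theorem sgn_mul_self (i : ZMod 2) : sgn k i * sgn k i = 1 := by
  rcases zmod_two_cases i with rfl | rfl <;> simp

theorem neg_one_pow_smul {M : Type*} [AddCommGroup M] [Module k M] (i j : ZMod 2) (x : M) :
    ((-1 : ℤˣ) ^ (i * j)) • x = if i = 1 ∧ j = 1 then -x else x := by
  have h10 : ¬ (1 : ZMod 2) = 0 := by decide
  rcases zmod_two_cases i with rfl | rfl <;> rcases zmod_two_cases j with rfl | rfl <;> simp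

variable {A : Type v} [Ring A] [Algebra k A] [Superalgebra k A]

theorem proj_mem (i : ZMod 2) (a : A) : proj k A i a ∈ gr k A i := by
  rw [proj, GradedAlgebra.proj_apply]
  exact SetLike.coe_mem _

theorem proj_zero_add_proj_one (a : A) : proj k A 0 a + proj k A 1 a = a := by
  have h01 : (0 : ZMod 2) ≠ 1 := by decide
  induction a using DirectSum.Decomposition.inductionOn (gr k A) with
  | zero => simp
  | @homogeneous i a =>
    rcases zmod_two_cases i with rfl | rfl
    · simp [proj_of_mem a.2, proj_of_mem_ne a.2 h01]
    · simp [proj_of_mem a.2, proj_of_mem_ne a.2 h01.symm]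
  | add a b ha hb =>
    rw [map_add, map_add, add_add_add_comm, ha, hb]

theorem parity_of_mem {i : ZMod 2} {a : A} (ha : a ∈ gr k A i) :
    parity k A a = sgn k i • a := by
  have h01 : (0 : ZMod 2) ≠ 1 := by decide
  rcases zmod_two_cases i with rfl | rfl
  · simp [parity, proj_of_mem ha, proj_of_mem_ne ha h01]
  · simp [parity, proj_of_mem ha, proj_of_mem_ne ha h01.symm]

/-- Additive maps that agree on homogeneous elements are equal. -/
theorem eq_of_homogeneous {M : Type*} [AddCommGroup M] [Module k M] {f g : A →ₗ[k] M}
    (h : ∀ i, ∀ a ∈ gr k A i, f a = g a) (a : A) : f a = g a := by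
  rw [← proj_zero_add_proj_one (k := k) a, map_add, map_add, h 0 _ (proj_mem 0 a),
    h 1 _ (proj_mem 1 a)]

theorem parity_parity (a : A) : parity k A (parity k A a) = a := by
  refine eq_of_homogeneous (f := parity k A ∘ₗ parity k A) (g := LinearMap.id) ?_ a
  intro i a ha
  simp [parity_of_mem ha, smul_smul, sgn_mul_self]

theorem parity_mul (a b : A) : parity k A (a * b) = parity k A a * parity k A b := by
  refine eq_of_homogeneous (f := parity k A ∘ₗ LinearMap.mulLeft k a)
    (g := LinearMap.mulLeft k (parity k A a) ∘ₗ parity k A) (fun j b hb => ?_) b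
  refine eq_of_homogeneous (f := parity k A ∘ₗ LinearMap.mulRight k b)
    (g := LinearMap.mulRight k (parity k A b) ∘ₗ parity k A) (fun i a ha => ?_) a
  have := parity_of_mem (SetLike.mul_mem_graded ha hb)
  simp [this, parity_of_mem ha, parity_of_mem hb, sgn_add, smul_smul, mul_comm]

theorem parity_one : parity k A 1 = 1 := by
  simp [parity_of_mem (k := k) (SetLike.GradedOne.one_mem (A := gr k A))]

variable (k A) in
/-- The parity automorphism as a homomorphism of algebras. -/
def parityHom : A →ₐ[k] A := AlgHom.ofLinearMap (parity k A) parity_one parity_mul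

@[simp] theorem parityHom_apply (a : A) : parityHom k A a = parity k A a := rfl

theorem two_smul_proj_zero (a : A) : (2 : k) • proj k A 0 a = a + parity k A a := by
  nth_rw 2 [← proj_zero_add_proj_one (k := k) a]
  simp only [parity, LinearMap.sub_apply, two_smul]
  abel

theorem two_smul_proj_one (a : A) : (2 : k) • proj k A 1 a = a - parity k A a := by
  nth_rw 2 [← proj_zero_add_proj_one (k := k) a]
  simp only [parity, LinearMap.sub_apply, two_smul]
  abel

/-- Since 2 is invertible, `(1 ± parity) / 2` are the projections, so the grading can be recovered
from the parity automorphism alone. -/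
theorem mem_gr_iff [NeZero (2 : k)] {i : ZMod 2} {a : A} :
    a ∈ gr k A i ↔ parity k A a = sgn k i • a := by
  refine ⟨parity_of_mem, fun h => ?_⟩
  have h2 : (2 : k) ≠ 0 := NeZero.ne 2
  have : proj k A i a = a := by
    apply smul_right_injective A h2
    rcases zmod_two_cases i with rfl | rfl
    · change (2 : k) • _ = (2 : k) • _
      rw [two_smul_proj_zero, h, two_smul, sgn_zero, one_smul]
    · change (2 : k) • _ = (2 : k) • _
      rw [two_smul_proj_one, h, two_smul, sgn_one, neg_smul, one_smul, sub_neg_eq_add]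
  rw [← this]
  exact proj_mem i a

theorem proj_parity (i : ZMod 2) (a : A) : proj k A i (parity k A a) = sgn k i • proj k A i a := by
  have h01 : (0 : ZMod 2) ≠ 1 := by decide
  refine eq_of_homogeneous (f := proj k A i ∘ₗ parity k A) (g := sgn k i • proj k A i) ?_ a
  intro j a ha
  by_cases hij : j = i
  · subst hij
    simp [parity_of_mem ha]
  · simp [parity_of_mem ha, proj_of_mem_ne ha hij]

theorem supercomm_symm {R : Type v} [Ring R] {p q : ZMod 2} {x y : R}
    (h : x * y = ((-1 : ℤˣ) ^ (p * q)) • (y * x)) : y * x = ((-1 : ℤˣ) ^ (q * p)) • (x * y) := by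
  rw [h, mul_comm q p, smul_smul, Int.units_mul_self, one_smul]

theorem supercomm_mul {R : Type v} [Ring R] {p p' q : ZMod 2} {x x' y : R}
    (h : x * y = ((-1 : ℤˣ) ^ (p * q)) • (y * x))
    (h' : x' * y = ((-1 : ℤˣ) ^ (p' * q)) • (y * x')) :
    x * x' * y = ((-1 : ℤˣ) ^ ((p + p') * q)) • (y * (x * x')) := by
  rw [mul_assoc, h', mul_smul_comm, ← mul_assoc, h, smul_mul_assoc, smul_smul, mul_assoc, add_mul,
    uzpow_add, mul_comm]

/-- The sign rule becomes a formula that is linear in each variable and makes sense for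
inhomogeneous elements, so it can be tested on spanning sets. -/
theorem mul_eq_of_supercomm {k : Type u} [Field k] {R : Type v} [Ring R] [Algebra k R]
    [Superalgebra k R] {i j : ZMod 2} {a b : R} (ha : a ∈ gr k R i) (hb : b ∈ gr k R j)
    (h : a * b = ((-1 : ℤˣ) ^ (i * j)) • (b * a)) :
    a * b = proj k R 0 b * a + proj k R 1 b * parity k R a := by
  have h01 : (0 : ZMod 2) ≠ 1 := by decide
  rw [neg_one_pow_smul (k := k)] at h
  rcases zmod_two_cases i with rfl | rfl <;> rcases zmod_two_cases j with rfl | rfl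
  · simp [proj_of_mem hb, proj_of_mem_ne hb h01, h]
  · simp [proj_of_mem hb, proj_of_mem_ne hb h01.symm, parity_of_mem ha, h]
  · simp [proj_of_mem hb, proj_of_mem_ne hb h01, h]
  · simp [proj_of_mem hb, proj_of_mem_ne hb h01.symm, parity_of_mem ha, h]

/-- Supercommutativity may be tested on the product formula with the parity automorphism. -/
theorem isSupercommutative_of_mul_eq {R : Type v} [Ring R] [Algebra k R] [Superalgebra k R]
    (h : ∀ a b : R, a * b = proj k R 0 b * a + proj k R 1 b * parity k R a) :
    IsSupercommutative k R := by
  have h01 : (0 : ZMod 2) ≠ 1 := by decide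
  intro i j a b ha hb
  rw [h a b, neg_one_pow_smul (k := k), parity_of_mem ha]
  rcases zmod_two_cases i with rfl | rfl <;> rcases zmod_two_cases j with rfl | rfl
  · simp [proj_of_mem hb, proj_of_mem_ne hb h01]
  · simp [proj_of_mem hb, proj_of_mem_ne hb h01.symm]
  · simp [proj_of_mem hb, proj_of_mem_ne hb h01]
  · simp [proj_of_mem hb, proj_of_mem_ne hb h01.symm]

/-- In a supercommutative superalgebra a homogeneous element commutes with everything up to
a power of the parity automorphism. -/
theorem IsSupercommutative.mul_eq (hA : IsSupercommutative k A) (a b : A) :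
    a * b = proj k A 0 b * a + proj k A 1 b * parity k A a := by
  refine eq_of_homogeneous (f := LinearMap.mulLeft k a)
    (g := LinearMap.mulRight k a ∘ₗ proj k A 0 +
      LinearMap.mulRight k (parity k A a) ∘ₗ proj k A 1) (fun j b hb => ?_) b
  refine eq_of_homogeneous (f := LinearMap.mulRight k b)
    (g := LinearMap.mulLeft k (proj k A 0 b) +
      LinearMap.mulLeft k (proj k A 1 b) ∘ₗ parity k A) (fun i a ha => ?_) a
  exact mul_eq_of_supercomm ha hb (hA i j a b ha hb)

theorem IsSupercommutative.even_mul (hA : IsSupercommutative k A) {a : A} (ha : a ∈ gr k A 0)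
    (b : A) : a * b = b * a := by
  rw [hA.mul_eq b a, proj_of_mem ha, proj_of_mem_ne ha (by decide), zero_mul, add_zero]

theorem IsSupercommutative.mul_odd (hA : IsSupercommutative k A) {a : A} (ha : a ∈ gr k A 1)
    (b : A) : b * a = a * parity k A b := by
  rw [hA.mul_eq b a, proj_of_mem ha, proj_of_mem_ne ha (by decide), zero_mul, zero_add]

theorem IsSuperHom.parity {B : Type v} [Ring B] [Algebra k B] [Superalgebra k B] {f : A →ₐ[k] B}
    (hf : IsSuperHom f) (a : A) : f (parity k A a) = SuperHopf.parity k B (f a) := by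
  refine eq_of_homogeneous (f := f.toLinearMap ∘ₗ SuperHopf.parity k A)
    (g := SuperHopf.parity k B ∘ₗ f.toLinearMap) (fun i a ha => ?_) a
  simp [parity_of_mem ha, parity_of_mem (hf i a ha)]

theorem IsSuperHom.proj {B : Type v} [Ring B] [Algebra k B] [Superalgebra k B] {f : A →ₐ[k] B}
    (hf : IsSuperHom f) (i : ZMod 2) (a : A) :
    f (SuperHopf.proj k A i a) = SuperHopf.proj k B i (f a) := by
  refine eq_of_homogeneous (f := f.toLinearMap ∘ₗ SuperHopf.proj k A i)
    (g := SuperHopf.proj k B i ∘ₗ f.toLinearMap) (fun j a ha => ?_) a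
  by_cases hij : j = i
  · subst hij
    simp [proj_of_mem ha, proj_of_mem (hf j a ha)]
  · simp [proj_of_mem_ne ha hij, proj_of_mem_ne (hf j a ha) hij]

theorem isSuperHom_of_parity [NeZero (2 : k)] {B : Type v} [Ring B] [Algebra k B]
    [Superalgebra k B] {f : A →ₐ[k] B}
    (hf : ∀ a, f (parity k A a) = SuperHopf.parity k B (f a)) : IsSuperHom f := by
  intro i a ha
  rw [mem_gr_iff, ← hf, parity_of_mem ha, map_smul]

end Parity

/-! ### Superalgebras from involutions -/

section Involution

/-- The eigenspaces of an algebra endomorphism for the eigenvalues `1` and `-1`. -/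
def eigenGrading {k : Type u} [Field k] {R : Type v} [Ring R] [Algebra k R] (τ : R →ₐ[k] R)
    (i : ZMod 2) : Submodule k R :=
  LinearMap.ker (τ.toLinearMap - sgn k i • LinearMap.id)

theorem mem_eigenGrading {k : Type u} [Field k] {R : Type v} [Ring R] [Algebra k R]
    {τ : R →ₐ[k] R} {i : ZMod 2} {x : R} : x ∈ eigenGrading τ i ↔ τ x = sgn k i • x := by
  simp [eigenGrading, sub_eq_zero]

variable {k : Type u} [Field k] {R : Type v} [Ring R] [Algebra k R]

/-- The component of parity `i` of an element with respect to an involution. -/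
def eigenComponent (τ : R →ₐ[k] R) (hτ : ∀ x, τ (τ x) = x) (i : ZMod 2) :
    R →ₗ[k] eigenGrading τ i :=
  LinearMap.codRestrict _ ((2 : k)⁻¹ • (LinearMap.id + sgn k i • τ.toLinearMap)) fun x => by
    rw [mem_eigenGrading]
    simp [hτ, smul_smul, mul_comm, mul_left_comm, sgn_mul_self, add_comm]

theorem eigenComponent_coe (τ : R →ₐ[k] R) (hτ : ∀ x, τ (τ x) = x) (i : ZMod 2) (x : R) :
    (eigenComponent τ hτ i x : R) = (2 : k)⁻¹ • (x + sgn k i • τ x) := rfl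

theorem eigenComponent_add [NeZero (2 : k)] (τ : R →ₐ[k] R) (hτ : ∀ x, τ (τ x) = x) (x : R) :
    (eigenComponent τ hτ 0 x : R) + eigenComponent τ hτ 1 x = x := by
  have h2 : (2 : k) ≠ 0 := NeZero.ne 2
  rw [eigenComponent_coe, eigenComponent_coe, ← smul_add, sgn_zero, sgn_one, neg_smul, one_smul]
  rw [add_add_add_comm, add_neg_cancel, add_zero, ← two_smul k, smul_smul, inv_mul_cancel₀ h2,
    one_smul]

theorem eigenComponent_of_mem [NeZero (2 : k)] (τ : R →ₐ[k] R) (hτ : ∀ x, τ (τ x) = x)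
    {i : ZMod 2} (x : eigenGrading τ i) : eigenComponent τ hτ i x = x := by
  have h2 : (2 : k) ≠ 0 := NeZero.ne 2
  ext
  rw [eigenComponent_coe, mem_eigenGrading.1 x.2, smul_smul, sgn_mul_self, one_smul,
    ← two_smul k, smul_smul, inv_mul_cancel₀ h2, one_smul]

theorem eigenComponent_of_mem_ne (τ : R →ₐ[k] R) (hτ : ∀ x, τ (τ x) = x)
    {i j : ZMod 2} (hij : i ≠ j) (x : eigenGrading τ i) : eigenComponent τ hτ j x = 0 := by
  have hs : sgn k j * sgn k i = -1 := by
    rcases zmod_two_cases i with rfl | rfl <;> rcases zmod_two_cases j with rfl | rfl <;>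
      simp_all
  ext
  rw [eigenComponent_coe, mem_eigenGrading.1 x.2, smul_smul, hs]
  simp

/-- An involution of an algebra in characteristic different from 2 makes it a superalgebra. -/
@[reducible]
def superalgebraOfInvolution [NeZero (2 : k)] (τ : R →ₐ[k] R) (hτ : ∀ x, τ (τ x) = x) :
    Superalgebra k R where
  grading := eigenGrading τ
  gradedAlgebra :=
    { one_mem := by simp [mem_eigenGrading]
      mul_mem := fun i j a b ha hb => by
        rw [mem_eigenGrading] at *
        simp [ha, hb, sgn_add, smul_smul, mul_comm]
      toDecomposition := DirectSum.Decomposition.ofLinearMap (eigenGrading τ)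
        (DirectSum.lof k (ZMod 2) (fun i => eigenGrading τ i) 0 ∘ₗ eigenComponent τ hτ 0 +
          DirectSum.lof k (ZMod 2) (fun i => eigenGrading τ i) 1 ∘ₗ eigenComponent τ hτ 1)
        (by
          ext x
          simp [eigenComponent_add])
        (by
          ext i x : 2
          rcases zmod_two_cases i with rfl | rfl
          · simp [eigenComponent_of_mem, eigenComponent_of_mem_ne τ hτ (zero_ne_one) x]
          · simp [eigenComponent_of_mem, eigenComponent_of_mem_ne τ hτ (one_ne_zero) x]) }

end Involution

/-! ### The super tensor product as a supercommutative superalgebra -/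

section GradedTensor

variable {k : Type u} [Field k]
variable {C : Type v} [Ring C] [Algebra k C] [Superalgebra k C]
variable {D : Type v} [Ring D] [Algebra k D] [Superalgebra k D]

variable (k C D) in
/-- The super tensor product of two superalgebras. -/
abbrev SuperTensor : Type v := GradedTensorProduct k (gr k C) (gr k D)

variable (k C D) in
/-- The inclusion `c ↦ c ⊗ 1`. -/
def inl : C →ₐ[k] SuperTensor k C D := GradedTensorProduct.includeLeft (gr k C) (gr k D)

variable (k C D) in
/-- The inclusion `d ↦ 1 ⊗ d`. -/
def inr : D →ₐ[k] SuperTensor k C D := GradedTensorProduct.includeRight (gr k C) (gr k D)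

variable (k C D) in
/-- The underlying vector space of the super tensor product. -/
def ofT : C ⊗[k] D ≃ₗ[k] SuperTensor k C D := GradedTensorProduct.of k (gr k C) (gr k D)

theorem inl_mul_inr (c : C) (d : D) : inl k C D c * inr k C D d = ofT k C D (c ⊗ₜ d) :=
  GradedTensorProduct.tmul_one_mul_one_tmul (gr k C) (gr k D) c d

theorem inr_mul_inl (c : C) (d : D) : inr k C D d * inl k C D c =
    ofT k C D (proj k C 0 c ⊗ₜ d) + ofT k C D (proj k C 1 c ⊗ₜ parity k D d) := by
  have h01 : (0 : ZMod 2) ≠ 1 := by decide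
  rw [← map_add]
  refine eq_of_homogeneous (f := LinearMap.mulLeft k (inr k C D d) ∘ₗ (inl k C D).toLinearMap)
    (g := (ofT k C D).toLinearMap ∘ₗ ((TensorProduct.mk k C D).flip d ∘ₗ proj k C 0 +
      (TensorProduct.mk k C D).flip (parity k D d) ∘ₗ proj k C 1)) (fun i c hc => ?_) c
  refine eq_of_homogeneous (f := LinearMap.mulRight k (inl k C D c) ∘ₗ (inr k C D).toLinearMap)
    (g := (ofT k C D).toLinearMap ∘ₗ (TensorProduct.mk k C D (proj k C 0 c) +
      TensorProduct.mk k C D (proj k C 1 c) ∘ₗ parity k D)) (fun j d hd => ?_) d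
  have h := GradedTensorProduct.tmul_coe_mul_coe_tmul (gr k C) (gr k D) (1 : C)
    (⟨d, hd⟩ : gr k D j) (⟨c, hc⟩ : gr k C i) (1 : D)
  simp only [one_mul, mul_one] at h
  rw [mul_comm j i, neg_one_pow_smul (k := k)] at h
  change inr k C D d * inl k C D c = if i = 1 ∧ j = 1 then -ofT k C D (c ⊗ₜ d) else
    ofT k C D (c ⊗ₜ d) at h
  rcases zmod_two_cases i with rfl | rfl <;> rcases zmod_two_cases j with rfl | rfl
  · simpa [proj_of_mem hc, proj_of_mem_ne hc h01] using h
  · simpa [proj_of_mem hc, proj_of_mem_ne hc h01] using h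
  · simpa [proj_of_mem hc, proj_of_mem_ne hc h01.symm, parity_of_mem hd] using h
  · simpa [proj_of_mem hc, proj_of_mem_ne hc h01.symm, parity_of_mem hd,
      TensorProduct.tmul_neg] using h

theorem inr_mul_inl' (c : C) (d : D) : inr k C D d * inl k C D c =
    ofT k C D (c ⊗ₜ proj k D 0 d) + ofT k C D (parity k C c ⊗ₜ proj k D 1 d) := by
  have hc := proj_zero_add_proj_one (k := k) c
  have hd := proj_zero_add_proj_one (k := k) d
  rw [inr_mul_inl, ← map_add, ← map_add]
  congr 1
  nth_rw 1 [← hd]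
  nth_rw 3 [← hc]
  simp only [parity, LinearMap.sub_apply, TensorProduct.tmul_sub, TensorProduct.sub_tmul,
    TensorProduct.tmul_add, TensorProduct.add_tmul]
  abel

theorem superTensor_ext {M : Type*} [AddCommGroup M] [Module k M]
    {f g : SuperTensor k C D →ₗ[k] M}
    (h : ∀ c d, f (inl k C D c * inr k C D d) = g (inl k C D c * inr k C D d)) : f = g := by
  refine GradedTensorProduct.hom_ext _ _ (TensorProduct.ext' fun c d => ?_)
  have := h c d
  rw [inl_mul_inr] at this
  exact this

theorem superTensor_ext_homogeneous {M : Type*} [AddCommGroup M] [Module k M]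
    {f g : SuperTensor k C D →ₗ[k] M}
    (h : ∀ i j, ∀ c ∈ gr k C i, ∀ d ∈ gr k D j,
      f (inl k C D c * inr k C D d) = g (inl k C D c * inr k C D d)) : f = g := by
  refine superTensor_ext fun c d => ?_
  refine eq_of_homogeneous (f := f ∘ₗ LinearMap.mulRight k (inr k C D d) ∘ₗ (inl k C D).toLinearMap)
    (g := g ∘ₗ LinearMap.mulRight k (inr k C D d) ∘ₗ (inl k C D).toLinearMap)
    (fun i c hc => ?_) c
  exact eq_of_homogeneous (f := f ∘ₗ LinearMap.mulLeft k (inl k C D c) ∘ₗ (inr k C D).toLinearMap)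
    (g := g ∘ₗ LinearMap.mulLeft k (inl k C D c) ∘ₗ (inr k C D).toLinearMap)
    (fun j d hd => h i j c hc d hd) d

theorem inr_mul_inl_of_mem {i j : ZMod 2} {c : C} (hc : c ∈ gr k C i) {d : D} (hd : d ∈ gr k D j) :
    inr k C D d * inl k C D c = ((-1 : ℤˣ) ^ (j * i)) • (inl k C D c * inr k C D d) := by
  have h01 : (0 : ZMod 2) ≠ 1 := by decide
  rw [inr_mul_inl, inl_mul_inr, mul_comm j i, neg_one_pow_smul (k := k)]
  rcases zmod_two_cases i with rfl | rfl <;> rcases zmod_two_cases j with rfl | rfl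
  · simp [proj_of_mem hc, proj_of_mem_ne hc h01]
  · simp [proj_of_mem hc, proj_of_mem_ne hc h01]
  · simp [proj_of_mem hc, proj_of_mem_ne hc h01.symm, parity_of_mem hd]
  · simp [proj_of_mem hc, proj_of_mem_ne hc h01.symm, parity_of_mem hd, TensorProduct.tmul_neg]

/-- Homomorphisms out of the super tensor product. -/
def superLift {E : Type v} [Ring E] [Algebra k E] (f : C →ₐ[k] E) (g : D →ₐ[k] E)
    (h : ∀ i j, ∀ c ∈ gr k C i, ∀ d ∈ gr k D j,
      f c * g d = ((-1 : ℤˣ) ^ (i * j)) • (g d * f c)) : SuperTensor k C D →ₐ[k] E :=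
  GradedTensorProduct.lift (gr k C) (gr k D) f g fun i j a b => by
    rw [mul_comm j i]
    exact h i j a a.2 b b.2

theorem superLift_inl {E : Type v} [Ring E] [Algebra k E] (f : C →ₐ[k] E) (g : D →ₐ[k] E) (h)
    (c : C) : superLift f g h (inl k C D c) = f c := by
  have := GradedTensorProduct.lift_tmul (gr k C) (gr k D) f g (fun i j a b => by
    rw [mul_comm j i]
    exact h i j a a.2 b b.2) c 1
  rw [map_one, mul_one] at this
  exact this

theorem superLift_inr {E : Type v} [Ring E] [Algebra k E] (f : C →ₐ[k] E) (g : D →ₐ[k] E) (h)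
    (d : D) : superLift f g h (inr k C D d) = g d := by
  have := GradedTensorProduct.lift_tmul (gr k C) (gr k D) f g (fun i j a b => by
    rw [mul_comm j i]
    exact h i j a a.2 b b.2) 1 d
  rw [map_one, one_mul] at this
  exact this

variable (k C D) in
/-- The parity automorphism of the super tensor product. -/
def tensorParity : SuperTensor k C D →ₐ[k] SuperTensor k C D :=
  superLift ((inl k C D).comp (parityHom k C)) ((inr k C D).comp (parityHom k D))
    fun i j c hc d hd => by
      have h : inl k C D c * inr k C D d = ((-1 : ℤˣ) ^ (i * j)) • (inr k C D d * inl k C D c) :=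
        supercomm_symm (inr_mul_inl_of_mem hc hd)
      simp only [AlgHom.comp_apply, parityHom_apply, parity_of_mem hc, parity_of_mem hd, map_smul,
        smul_mul_smul_comm, h]
      rw [smul_comm, mul_comm (sgn k i)]

@[simp] theorem tensorParity_inl (c : C) :
    tensorParity k C D (inl k C D c) = inl k C D (parity k C c) := superLift_inl _ _ _ c

@[simp] theorem tensorParity_inr (d : D) :
    tensorParity k C D (inr k C D d) = inr k C D (parity k D d) := superLift_inr _ _ _ d

theorem tensorParity_tensorParity (x : SuperTensor k C D) :
    tensorParity k C D (tensorParity k C D x) = x := by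
  have : (tensorParity k C D).toLinearMap ∘ₗ (tensorParity k C D).toLinearMap = LinearMap.id :=
    superTensor_ext fun c d => by simp [parity_parity]
  exact LinearMap.congr_fun this x

instance [NeZero (2 : k)] : Superalgebra k (SuperTensor k C D) :=
  superalgebraOfInvolution (tensorParity k C D) tensorParity_tensorParity

theorem IsSupercommutative.inl_mul_inr_supercomm (hC : IsSupercommutative k C)
    (hD : IsSupercommutative k D) {i j i' j' : ZMod 2} {c c' : C} (hc : c ∈ gr k C i)
    (hc' : c' ∈ gr k C i') {d d' : D} (hd : d ∈ gr k D j) (hd' : d' ∈ gr k D j') :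
    inl k C D c * inr k C D d * (inl k C D c' * inr k C D d') =
      ((-1 : ℤˣ) ^ ((i + j) * (i' + j'))) •
        (inl k C D c' * inr k C D d' * (inl k C D c * inr k C D d)) := by
  have hcc : inl k C D c * inl k C D c' =
      ((-1 : ℤˣ) ^ (i * i')) • (inl k C D c' * inl k C D c) := by
    rw [← map_mul, ← map_mul, hC i i' c c' hc hc', AlgHom.map_smul_of_tower]
  have hdd : inr k C D d * inr k C D d' =
      ((-1 : ℤˣ) ^ (j * j')) • (inr k C D d' * inr k C D d) := by
    rw [← map_mul, ← map_mul, hD j j' d d' hd hd', AlgHom.map_smul_of_tower]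
  have h1 := supercomm_mul hcc (inr_mul_inl_of_mem hc' hd)
  have h2 := supercomm_mul (supercomm_symm (inr_mul_inl_of_mem hc hd')) hdd
  exact supercomm_symm (supercomm_mul (supercomm_symm h1) (supercomm_symm h2))

variable [NeZero (2 : k)]

theorem parity_superTensor (x : SuperTensor k C D) :
    parity k (SuperTensor k C D) x = tensorParity k C D x := by
  refine eq_of_homogeneous (f := parity k (SuperTensor k C D))
    (g := (tensorParity k C D).toLinearMap) (fun i x hx => ?_) x
  rw [parity_of_mem hx]
  exact (mem_eigenGrading.1 hx).symm

theorem isSuperHom_inl : IsSuperHom (inl k C D) :=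
  isSuperHom_of_parity fun c => by rw [parity_superTensor, tensorParity_inl]

theorem isSuperHom_inr : IsSuperHom (inr k C D) :=
  isSuperHom_of_parity fun c => by rw [parity_superTensor, tensorParity_inr]

theorem inl_mul_inr_mem {i j : ZMod 2} {c : C} (hc : c ∈ gr k C i) {d : D} (hd : d ∈ gr k D j) :
    inl k C D c * inr k C D d ∈ gr k (SuperTensor k C D) (i + j) :=
  SetLike.mul_mem_graded (isSuperHom_inl i c hc) (isSuperHom_inr j d hd)

/-- The super tensor product of supercommutative superalgebras is supercommutative. -/
theorem IsSupercommutative.superTensor (hC : IsSupercommutative k C) (hD : IsSupercommutative k D) :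
    IsSupercommutative k (SuperTensor k C D) := by
  refine isSupercommutative_of_mul_eq fun x y => ?_
  -- Both sides of the product formula are linear in `x` and in `y`, so it suffices to check
  -- products `c ⊗ d` of homogeneous elements, one variable at a time.
  have key : LinearMap.mulLeft k x = LinearMap.mulRight k x ∘ₗ proj k (SuperTensor k C D) 0 +
      LinearMap.mulRight k (parity k (SuperTensor k C D) x) ∘ₗ proj k (SuperTensor k C D) 1 := by
    refine superTensor_ext_homogeneous fun i' j' c' hc' d' hd' => ?_
    have key' : LinearMap.mulRight k (inl k C D c' * inr k C D d') =
        LinearMap.mulLeft k (proj k (SuperTensor k C D) 0 (inl k C D c' * inr k C D d')) +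
          LinearMap.mulLeft k (proj k (SuperTensor k C D) 1 (inl k C D c' * inr k C D d')) ∘ₗ
            parity k (SuperTensor k C D) := by
      refine superTensor_ext_homogeneous fun i j c hc d hd => ?_
      exact mul_eq_of_supercomm (inl_mul_inr_mem hc hd) (inl_mul_inr_mem hc' hd')
        (hC.inl_mul_inr_supercomm hD hc hc' hd hd')
    exact LinearMap.congr_fun key' x
  exact LinearMap.congr_fun key y

end GradedTensor

/-! ### Convolution algebras and the antipode -/

section HopfBasics

open WithConv

variable {k : Type u} [Field k] {A : Type v} [Ring A] [Algebra k A] [HopfSuperalgebra k A]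

theorem comul_parity (a : A) : comul (R := k) (parity k A a) =
    TensorProduct.map (parity k A) (parity k A) (comul (R := k) a) := by
  have e1 : (0 : ZMod 2) - 1 = 1 := by decide
  have hu : (Finset.univ : Finset (ZMod 2)) = {0, 1} := by decide
  have h : TensorProduct.map (parity k A) (parity k A) = tensorProj k A 0 - tensorProj k A 1 := by
    refine TensorProduct.ext' fun a b => ?_
    simp only [tensorProj, hu, Finset.sum_pair (zero_ne_one), sub_zero, sub_self, e1,
      LinearMap.sub_apply, LinearMap.add_apply, TensorProduct.map_tmul, parity,
      TensorProduct.sub_tmul, TensorProduct.tmul_sub]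
    abel
  have h0 := LinearMap.congr_fun (HopfSuperalgebra.comul_proj (k := k) (A := A) 0) a
  have h1 := LinearMap.congr_fun (HopfSuperalgebra.comul_proj (k := k) (A := A) 1) a
  rw [LinearMap.comp_apply, LinearMap.comp_apply] at h0 h1
  rw [h, LinearMap.sub_apply, ← h0, ← h1, ← map_sub, parity, LinearMap.sub_apply]

theorem counit_parity (a : A) : counit (R := k) (parity k A a) = counit (R := k) a := by
  have h : counit (R := k) (proj k A 1 a) = 0 :=
    HopfSuperalgebra.counit_odd _ (proj_mem 1 a)
  nth_rw 2 [← proj_zero_add_proj_one (k := k) a]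
  rw [parity, LinearMap.sub_apply, map_sub, map_add, h, sub_zero, add_zero]

theorem antipode_parity (a : A) :
    antipode (k := k) (parity k A a) = parity k A (antipode (k := k) a) := by
  refine eq_of_homogeneous (f := antipode (k := k) ∘ₗ parity k A)
    (g := parity k A ∘ₗ antipode (k := k)) (fun i a ha => ?_) a
  simp [parity_of_mem ha, parity_of_mem (HopfSuperalgebra.antipode_mem i a ha)]

variable (k A) in
/-- The parity automorphism of a Hopf superalgebra as a homomorphism of coalgebras. -/
def parityCoalgHom : A →ₗc[k] A where
  toLinearMap := parity k A
  counit_comp := LinearMap.ext counit_parity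
  map_comp_comul := LinearMap.ext fun a => (comul_parity a).symm

variable (k A) in
/-- The comultiplication as a homomorphism of algebras. -/
def comulHom : A →ₐ[k] SuperTensor k A A :=
  AlgHom.ofLinearMap ((ofT k A A).toLinearMap ∘ₗ comul)
    (congrArg (ofT k A A) (HopfSuperalgebra.comul_one (k := k) (A := A)))
    (HopfSuperalgebra.comul_mul (k := k) (A := A))

theorem comulHom_apply (a : A) : comulHom k A a = ofT k A A (comul (R := k) a) := rfl

variable (k A) in
/-- The counit as a homomorphism of algebras. -/
def counitHom : A →ₐ[k] k :=
  AlgHom.ofLinearMap counit HopfSuperalgebra.counit_one HopfSuperalgebra.counit_mul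

@[simp] theorem counitHom_apply (a : A) : counitHom k A a = counit (R := k) a := rfl

variable {R : Type*} [Ring R] [Algebra k R]

theorem algHom_comp_conv_mul {R' : Type*} [Ring R'] [Algebra k R'] (F : R →ₐ[k] R')
    (f g : A →ₗ[k] R) :
    toConv (F.toLinearMap ∘ₗ (toConv f * toConv g).ofConv) =
      toConv (F.toLinearMap ∘ₗ f) * toConv (F.toLinearMap ∘ₗ g) :=
  congrArg toConv (LinearMap.algHom_comp_convMul_distrib F (toConv f) (toConv g))

theorem algHom_comp_conv_one {R' : Type*} [Ring R'] [Algebra k R'] (F : R →ₐ[k] R') :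
    toConv (F.toLinearMap ∘ₗ (1 : WithConv (A →ₗ[k] R)).ofConv) =
      (1 : WithConv (A →ₗ[k] R')) := by
  ext a
  simp [LinearMap.convOne_def]

theorem id_mul_antipode :
    toConv (LinearMap.id : A →ₗ[k] A) * toConv (antipode (k := k)) = 1 :=
  congrArg toConv (HopfSuperalgebra.mul_antipode_lTensor_comul (k := k) (A := A))

theorem antipode_mul_id :
    toConv (antipode (k := k)) * toConv (LinearMap.id : A →ₗ[k] A) = 1 :=
  congrArg toConv (HopfSuperalgebra.mul_antipode_rTensor_comul (k := k) (A := A))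

/-- Composition with an algebra homomorphism respects convolution, so the identity `id * S = 1` can
be pushed forward to any point. No commutativity of `R` is needed. -/
theorem mul_comp_antipode (f : A →ₐ[k] R) :
    toConv f.toLinearMap * toConv (f.toLinearMap ∘ₗ antipode (k := k)) = 1 := by
  have h := algHom_comp_conv_mul f LinearMap.id (antipode (k := k))
  rw [id_mul_antipode, algHom_comp_conv_one, LinearMap.comp_id] at h
  exact h.symm

theorem comp_antipode_mul (f : A →ₐ[k] R) :
    toConv (f.toLinearMap ∘ₗ antipode (k := k)) * toConv f.toLinearMap = 1 := by
  have h := algHom_comp_conv_mul f (antipode (k := k)) LinearMap.id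
  rw [antipode_mul_id, algHom_comp_conv_one, LinearMap.comp_id] at h
  exact h.symm

theorem comulHom_eq : toConv (comulHom k A).toLinearMap =
    toConv (inl k A A).toLinearMap * toConv (inr k A A).toLinearMap := by
  have h : (ofT k A A).toLinearMap = LinearMap.mul' k (SuperTensor k A A) ∘ₗ
      TensorProduct.map (inl k A A).toLinearMap (inr k A A).toLinearMap :=
    TensorProduct.ext' fun a b => (inl_mul_inr a b).symm
  ext a
  exact LinearMap.congr_fun h (comul (R := k) a)

/-- This is `(g h)⁻¹ = h⁻¹ g⁻¹` for the two universal points: both sides are convolution inverses of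
`inl * inr`. -/
theorem comulHom_antipode : toConv ((comulHom k A).toLinearMap ∘ₗ antipode (k := k)) =
    toConv ((inr k A A).toLinearMap ∘ₗ antipode (k := k)) *
      toConv ((inl k A A).toLinearMap ∘ₗ antipode (k := k)) := by
  refine left_inv_eq_right_inv (comp_antipode_mul (comulHom k A)) ?_
  rw [comulHom_eq, mul_assoc, ← mul_assoc (toConv (inr k A A).toLinearMap), mul_comp_antipode,
    one_mul, mul_comp_antipode]

variable (k A) in
/-- The map `a ↦ ∑ S(a₁) ⊗ a₂`, which represents `(g, h) ↦ g⁻¹ h`. -/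
def shearInvRight : A →ₗ[k] SuperTensor k A A :=
  (toConv ((inl k A A).toLinearMap ∘ₗ antipode (k := k)) *
    toConv (inr k A A).toLinearMap).ofConv

variable (k A) in
/-- The inverse `a ⊗ b ↦ ∑ a S(b₁) ⊗ b₂` of `shear`. -/
def shearInv : SuperTensor k A A →ₗ[k] SuperTensor k A A :=
  LinearMap.mul' k (SuperTensor k A A) ∘ₗ
    TensorProduct.map (inl k A A).toLinearMap (shearInvRight k A) ∘ₗ (ofT k A A).symm.toLinearMap

theorem shearInv_mul (a b : A) :
    shearInv k A (inl k A A a * inr k A A b) = inl k A A a * shearInvRight k A b := by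
  rw [inl_mul_inr, shearInv]
  simp

theorem shearInv_inl_mul (a : A) (x : SuperTensor k A A) :
    shearInv k A (inl k A A a * x) = inl k A A a * shearInv k A x := by
  have : shearInv k A ∘ₗ LinearMap.mulLeft k (inl k A A a) =
      LinearMap.mulLeft k (inl k A A a) ∘ₗ shearInv k A := by
    refine superTensor_ext fun c d => ?_
    simp only [LinearMap.comp_apply, LinearMap.mulLeft_apply]
    rw [← mul_assoc, ← map_mul, shearInv_mul, shearInv_mul, map_mul, mul_assoc]
  exact LinearMap.congr_fun this x

theorem shearInv_comulHom (a : A) : shearInv k A (comulHom k A a) = inr k A A a := by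
  have h : toConv (shearInv k A ∘ₗ (comulHom k A).toLinearMap) =
      toConv (inl k A A).toLinearMap * toConv (shearInvRight k A) := rfl
  rw [shearInvRight, WithConv.toConv_ofConv, ← mul_assoc, mul_comp_antipode, one_mul] at h
  exact LinearMap.congr_fun (congrArg ofConv h) a

theorem antipode_one : antipode (k := k) (1 : A) = 1 := by
  have h := LinearMap.congr_fun (HopfSuperalgebra.mul_antipode_lTensor_comul (k := k) (A := A)) 1
  simpa [HopfSuperalgebra.comul_one, HopfSuperalgebra.counit_one] using h

variable (k A) in
/-- The homomorphism `a ⊗ b ↦ a ε(b)`. -/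
def counitRight : SuperTensor k A A →ₐ[k] A :=
  superLift (AlgHom.id k A) ((Algebra.ofId k A).comp (counitHom k A)) fun i j c hc d hd => by
    rcases zmod_two_cases j with rfl | rfl
    · rw [neg_one_pow_smul (k := k)]
      simpa using (Algebra.commutes _ c).symm
    · have : counit (R := k) d = 0 := HopfSuperalgebra.counit_odd d hd
      simp [this]

theorem counitRight_inl (a : A) : counitRight k A (inl k A A a) = a := by
  rw [counitRight, superLift_inl, AlgHom.id_apply]

theorem counitRight_inr (a : A) :
    counitRight k A (inr k A A a) = algebraMap k A (counit (R := k) a) := by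
  rw [counitRight, superLift_inr]
  rfl

section Super

variable [NeZero (2 : k)]

theorem isSuperHom_comulHom : IsSuperHom (comulHom k A) :=
  isSuperHom_of_parity fun a => by
    have h : (tensorParity k A A).toLinearMap ∘ₗ (ofT k A A).toLinearMap =
        (ofT k A A).toLinearMap ∘ₗ TensorProduct.map (parity k A) (parity k A) := by
      refine TensorProduct.ext' fun a b => ?_
      change tensorParity k A A (ofT k A A (a ⊗ₜ b)) =
        ofT k A A (parity k A a ⊗ₜ parity k A b)
      rw [← inl_mul_inr, ← inl_mul_inr]
      simp
    rw [parity_superTensor, comulHom_apply, comulHom_apply, comul_parity]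
    exact (LinearMap.congr_fun h _).symm

/-- The endomorphism `a ⊗ b ↦ ∑ a b₁ ⊗ b₂` of the algebra `A ⊗ A`, which represents
`(g, h) ↦ (g, g h)`. -/
def shear (hA : IsSupercommutative k A) : SuperTensor k A A →ₐ[k] SuperTensor k A A :=
  superLift (inl k A A) (comulHom k A) fun i j c hc d hd =>
    hA.superTensor hA i j _ _ (isSuperHom_inl i c hc) (isSuperHom_comulHom j d hd)

theorem shear_inl (hA : IsSupercommutative k A) (a : A) :
    shear hA (inl k A A a) = inl k A A a := by
  rw [shear, superLift_inl]

theorem shear_inr (hA : IsSupercommutative k A) (a : A) :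
    shear hA (inr k A A a) = comulHom k A a := by
  rw [shear, superLift_inr]

theorem shearInv_shear (hA : IsSupercommutative k A) (x : SuperTensor k A A) :
    shearInv k A (shear hA x) = x := by
  have : shearInv k A ∘ₗ (shear hA).toLinearMap = LinearMap.id := by
    refine superTensor_ext fun c d => ?_
    simp only [LinearMap.comp_apply, AlgHom.toLinearMap_apply, map_mul, LinearMap.id_apply]
    rw [shear_inl, shear_inr, shearInv_inl_mul, shearInv_comulHom]
  exact LinearMap.congr_fun this x

theorem shear_shearInvRight (hA : IsSupercommutative k A) (a : A) :
    shear hA (shearInvRight k A a) = inr k A A a := by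
  have h := algHom_comp_conv_mul (shear hA) ((inl k A A).toLinearMap ∘ₗ antipode (k := k))
    (inr k A A).toLinearMap
  have h1 : (shear hA).toLinearMap ∘ₗ (inl k A A).toLinearMap = (inl k A A).toLinearMap :=
    LinearMap.ext fun c => shear_inl hA c
  have h2 : (shear hA).toLinearMap ∘ₗ (inr k A A).toLinearMap = (comulHom k A).toLinearMap :=
    LinearMap.ext fun c => shear_inr hA c
  rw [← LinearMap.comp_assoc, h1, h2, comulHom_eq, ← mul_assoc, comp_antipode_mul, one_mul] at h
  exact LinearMap.congr_fun (congrArg ofConv h) a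

/-- `shear` is an algebra homomorphism with a linear left inverse, hence injective, and it carries
`shearInvRight` to the multiplicative map `inr`. -/
theorem shearInvRight_mul (hA : IsSupercommutative k A) (a b : A) :
    shearInvRight k A (a * b) = shearInvRight k A a * shearInvRight k A b := by
  have h : shear hA (shearInvRight k A a * shearInvRight k A b) =
      shear hA (shearInvRight k A (a * b)) := by
    simp only [map_mul, shear_shearInvRight]
  rw [← shearInv_shear hA (shearInvRight k A (a * b)), ← h, shearInv_shear]

/-- Applying the counit to the second leg of `∑ S(a₁) ⊗ a₂` returns `S(a)`, so the antipode is a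
composite of multiplicative maps. -/
theorem antipode_mul (hA : IsSupercommutative k A) (a b : A) :
    antipode (k := k) (a * b) = antipode (k := k) a * antipode (k := k) b := by
  have h : toConv ((counitRight k A).toLinearMap ∘ₗ shearInvRight k A) =
      toConv (antipode (k := k)) := by
    rw [shearInvRight, algHom_comp_conv_mul]
    have h1 : (counitRight k A).toLinearMap ∘ₗ (inl k A A).toLinearMap = LinearMap.id :=
      LinearMap.ext counitRight_inl
    have h2 : toConv ((counitRight k A).toLinearMap ∘ₗ (inr k A A).toLinearMap) = 1 := by
      ext c
      exact counitRight_inr c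
    rw [← LinearMap.comp_assoc, h1, h2, mul_one, LinearMap.id_comp]
  have h' (c : A) : counitRight k A (shearInvRight k A c) = antipode (k := k) c :=
    LinearMap.congr_fun (congrArg ofConv h) c
  rw [← h', ← h', ← h', shearInvRight_mul hA, map_mul]

/-- The antipode of a supercommutative Hopf superalgebra as a homomorphism of algebras. -/
def antipodeHom (hA : IsSupercommutative k A) : A →ₐ[k] A :=
  AlgHom.ofLinearMap (antipode (k := k)) antipode_one (antipode_mul hA)

/-- As the antipode is an algebra homomorphism, `S ∘ S` is a convolution inverse of `S`; so is the
identity. -/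
theorem antipode_antipode (hA : IsSupercommutative k A) (a : A) :
    antipode (k := k) (antipode (k := k) a) = a := by
  have h := left_inv_eq_right_inv (id_mul_antipode (k := k) (A := A))
    (mul_comp_antipode (antipodeHom hA))
  exact (LinearMap.congr_fun (congrArg ofConv h) a).symm

end Super

end HopfBasics

/-! ### Slice maps and unsigned convolution of functionals -/

section Slices

variable {k : Type u} [Field k] {B : Type v} [Ring B] [Algebra k B]
variable {C : Type v} [Ring C] [Algebra k C]

variable (C) in
/-- The slice map `c ⊗ b ↦ φ(b) c`. -/
def rslice (φ : Module.Dual k B) : C ⊗[k] B →ₗ[k] C :=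
  (TensorProduct.rid k C).toLinearMap ∘ₗ φ.lTensor C

variable (C) in
/-- The slice map `b ⊗ c ↦ φ(b) c`. -/
def lslice (φ : Module.Dual k B) : B ⊗[k] C →ₗ[k] C :=
  (TensorProduct.lid k C).toLinearMap ∘ₗ φ.rTensor C

@[simp] theorem rslice_tmul (φ : Module.Dual k B) (c : C) (b : B) :
    rslice C φ (c ⊗ₜ b) = φ b • c := by
  simp [rslice]

@[simp] theorem lslice_tmul (φ : Module.Dual k B) (c : C) (b : B) :
    lslice C φ (b ⊗ₜ c) = φ b • c := by
  simp [lslice]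

theorem rslice_smul (c : k) (φ : Module.Dual k B) : rslice C (c • φ) = c • rslice C φ :=
  TensorProduct.ext' fun a b => by simp [smul_smul]

theorem lslice_smul (c : k) (φ : Module.Dual k B) : lslice C (c • φ) = c • lslice C φ :=
  TensorProduct.ext' fun a b => by simp [smul_smul]

theorem apply_rslice (f : Module.Dual k C) (φ : Module.Dual k B) (x : C ⊗[k] B) :
    f (rslice C φ x) = φ (lslice B f x) := by
  have : f ∘ₗ rslice C φ = φ ∘ₗ lslice B f :=
    TensorProduct.ext' fun c b => by simp [mul_comm]
  exact LinearMap.congr_fun this x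

theorem eq_of_forall_dual {x y : C} (h : ∀ f : Module.Dual k C, f x = f y) : x = y := by
  rw [← sub_eq_zero, ← Module.forall_dual_apply_eq_zero_iff k]
  intro f
  rw [map_sub, h f, sub_self]

/-- A tensor all of whose slices lie in a subspace `V` is mapped to `W` by any bilinear map that
takes `V` to `W`. -/
theorem lift_mem_of_rslice_mem [FiniteDimensional k B] {E : Type v} [AddCommGroup E] [Module k E]
    {V : Submodule k C} {W : Submodule k E} (μ : C →ₗ[k] B →ₗ[k] E)
    (hμ : ∀ c ∈ V, ∀ b, μ c b ∈ W) (x : C ⊗[k] B)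
    (hx : ∀ f, rslice C f x ∈ V) : TensorProduct.lift μ x ∈ W := by
  let e := Module.finBasis k B
  have h : LinearMap.id = ∑ i, (TensorProduct.mk k C B).flip (e i) ∘ₗ rslice C (e.coord i) := by
    refine TensorProduct.ext' fun c b => ?_
    simp only [LinearMap.id_apply, LinearMap.sum_apply, LinearMap.comp_apply, rslice_tmul,
      LinearMap.flip_apply, TensorProduct.mk_apply, TensorProduct.smul_tmul]
    rw [← TensorProduct.tmul_sum]
    congr 1
    exact (e.sum_repr b).symm
  have hx' := LinearMap.congr_fun h x
  rw [LinearMap.id_apply] at hx'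
  rw [hx', LinearMap.sum_apply, map_sum]
  refine Submodule.sum_mem _ fun i _ => ?_
  simpa using hμ _ (hx (e.coord i)) (e i)

theorem tensor_ext_rslice [FiniteDimensional k B] {x y : C ⊗[k] B}
    (h : ∀ f, rslice C f x = rslice C f y) : x = y := by
  have := lift_mem_of_rslice_mem (V := (⊥ : Submodule k C)) (W := (⊥ : Submodule k (C ⊗[k] B)))
    (TensorProduct.mk k C B) (by rintro _ rfl b; simp) (x - y) (fun f => by simp [h f])
  rw [TensorProduct.lift_mk, LinearMap.id_apply, Submodule.mem_bot, sub_eq_zero] at this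
  exact this

variable [Coalgebra k B]

/-- The convolution product of functionals, without signs. -/
def conv (f φ : Module.Dual k B) : Module.Dual k B :=
  LinearMap.mul' k k ∘ₗ TensorProduct.map f φ ∘ₗ comul

theorem conv_apply (f φ : Module.Dual k B) (b : B) :
    conv f φ b = f (rslice B φ (comul (R := k) b)) := by
  have : LinearMap.mul' k k ∘ₗ TensorProduct.map f φ = f ∘ₗ rslice B φ :=
    TensorProduct.ext' fun c b => by simp [mul_comm]
  exact LinearMap.congr_fun this _

theorem conv_apply' (f φ : Module.Dual k B) (b : B) :
    conv f φ b = φ (lslice B f (comul (R := k) b)) := by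
  rw [conv_apply, apply_rslice]

/-- Coassociativity: iterated slicing is an action of the unsigned convolution algebra on `B`. -/
theorem rslice_conv (f φ : Module.Dual k B) (b : B) :
    rslice B (conv f φ) (comul (R := k) b) =
      rslice B f (comul (R := k) (rslice B φ (comul (R := k) b))) := by
  have h1 : rslice B f ∘ₗ comul ∘ₗ rslice B φ =
      rslice B (LinearMap.mul' k k ∘ₗ TensorProduct.map f φ) ∘ₗ
        (TensorProduct.assoc k B B B).toLinearMap ∘ₗ comul.rTensor B := by
    refine TensorProduct.ext' fun x y => ?_
    have h2 : φ y • rslice B f = rslice B (LinearMap.mul' k k ∘ₗ TensorProduct.map f φ) ∘ₗ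
        (TensorProduct.assoc k B B B).toLinearMap ∘ₗ (TensorProduct.mk k (B ⊗[k] B) B).flip y :=
      TensorProduct.ext' fun a b => by simp [smul_smul, mul_comm]
    have := LinearMap.congr_fun h2 (comul x)
    simpa using this
  have h3 : rslice B (conv f φ) =
      rslice B (LinearMap.mul' k k ∘ₗ TensorProduct.map f φ) ∘ₗ comul.lTensor B :=
    TensorProduct.ext' fun x y => by simp [conv]
  have := LinearMap.congr_fun h1 (comul (R := k) b)
  simp only [LinearMap.comp_apply] at this
  rw [this, h3, LinearMap.comp_apply]
  congr 1
  exact (Coalgebra.coassoc_apply b).symm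

theorem counit_rslice (φ : Module.Dual k B) (b : B) :
    counit (R := k) (rslice B φ (comul (R := k) b)) = φ b := by
  rw [apply_rslice]
  simp [lslice]

theorem counit_lslice (φ : Module.Dual k B) (b : B) :
    counit (R := k) (lslice B φ (comul (R := k) b)) = φ b := by
  rw [← apply_rslice]
  simp [rslice]

end Slices

/-! ### Integrals characterised by slices of the comultiplication -/

section Integrals

variable {k : Type u} [Field k] {B : Type v} [Ring B] [Algebra k B] [HopfSuperalgebra k B]

theorem rslice_signTwist (φ : Module.Dual k B) (x : B ⊗[k] B) :
    rslice B φ (signTwist k B x) =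
      proj k B 0 (rslice B φ x) + proj k B 1 (rslice B (φ ∘ₗ parity k B) x) := by
  have : rslice B φ ∘ₗ signTwist k B =
      proj k B 0 ∘ₗ rslice B φ + proj k B 1 ∘ₗ rslice B (φ ∘ₗ parity k B) :=
    TensorProduct.ext' fun a b => by simp [signTwist]
  exact LinearMap.congr_fun this x

theorem lslice_signTwist (φ : Module.Dual k B) (x : B ⊗[k] B) :
    lslice B φ (signTwist k B x) =
      proj k B 0 (lslice B φ x) + proj k B 1 (lslice B (φ ∘ₗ parity k B) x) := by
  have : lslice B φ ∘ₗ signTwist k B =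
      proj k B 0 ∘ₗ lslice B φ + proj k B 1 ∘ₗ lslice B (φ ∘ₗ parity k B) := by
    refine TensorProduct.ext' fun a b => ?_
    have ha := proj_zero_add_proj_one (k := k) a
    have hb := proj_zero_add_proj_one (k := k) b
    simp only [signTwist, LinearMap.comp_apply, LinearMap.add_apply, TensorProduct.map_tmul,
      map_add, lslice_tmul, LinearMap.id_apply, map_smul]
    nth_rw 1 [← hb]
    nth_rw 3 [← ha]
    simp only [parity, LinearMap.sub_apply, map_add, map_sub]
    module
  exact LinearMap.congr_fun this x

theorem parity_rslice (φ : Module.Dual k B) (b : B) :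
    parity k B (rslice B φ (comul (R := k) (parity k B b))) =
      rslice B (φ ∘ₗ parity k B) (comul (R := k) b) := by
  have : parity k B ∘ₗ rslice B φ ∘ₗ TensorProduct.map (parity k B) (parity k B) =
      rslice B (φ ∘ₗ parity k B) :=
    TensorProduct.ext' fun a b => by simp [parity_parity]
  rw [comul_parity]
  exact LinearMap.congr_fun this _

theorem parity_lslice (φ : Module.Dual k B) (b : B) :
    parity k B (lslice B φ (comul (R := k) (parity k B b))) =
      lslice B (φ ∘ₗ parity k B) (comul (R := k) b) := by
  have : parity k B ∘ₗ lslice B φ ∘ₗ TensorProduct.map (parity k B) (parity k B) =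
      lslice B (φ ∘ₗ parity k B) :=
    TensorProduct.ext' fun a b => by simp [parity_parity]
  rw [comul_parity]
  exact LinearMap.congr_fun this _

/-- This removes the sign from the dual product. Because `d` is even, the even part of the signed
identity at `b` gives the even part of `D b`, and its odd part at `parity b` forces the odd part of
`D b` to vanish. -/
theorem proj_eq_iff {D : B → B} {φ : B → k} {d : B} (hd : d ∈ gr k B 0) :
    (∀ b, proj k B 0 (D b) + proj k B 1 (parity k B (D (parity k B b))) = φ b • d) ↔
      ∀ b, D b = φ b • d := by
  have h10 : (0 : ZMod 2) ≠ 1 := by decide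
  have hd1 : proj k B 1 d = 0 := proj_of_mem_ne hd h10
  have hd0 : proj k B 0 d = d := proj_of_mem hd
  have e0 (x : B) : proj k B 0 (proj k B 0 x) = proj k B 0 x := proj_of_mem (proj_mem 0 x)
  have e1 (x : B) : proj k B 1 (proj k B 1 x) = proj k B 1 x := proj_of_mem (proj_mem 1 x)
  have e01 (x : B) : proj k B 0 (proj k B 1 x) = 0 := proj_of_mem_ne (proj_mem 1 x) h10.symm
  have e10 (x : B) : proj k B 1 (proj k B 0 x) = 0 := proj_of_mem_ne (proj_mem 0 x) h10
  constructor
  · intro h b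
    have h0 := congrArg (proj k B 0) (h b)
    have h1 := congrArg (proj k B 1) (h (parity k B b))
    simp only [map_add, e0, e01, e10, e1, map_smul, hd0, hd1, parity_parity, proj_parity] at h0 h1
    rw [← proj_zero_add_proj_one (k := k) (D b)]
    simp at h0 h1
    rw [h0, h1, add_zero]
  · intro h b
    simp [h, hd0, hd1, proj_parity]

theorem dualMul_apply (f φ : Module.Dual k B) (b : B) :
    dualMul f φ b = f (proj k B 0 (rslice B φ (comul (R := k) b)) +
      proj k B 1 (parity k B (rslice B φ (comul (R := k) (parity k B b))))) := by
  rw [parity_rslice, ← rslice_signTwist]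
  have : LinearMap.mul' k k ∘ₗ TensorProduct.map f φ = f ∘ₗ rslice B φ :=
    TensorProduct.ext' fun c b => by simp [mul_comm]
  exact LinearMap.congr_fun this _

theorem dualMul_apply' (f φ : Module.Dual k B) (b : B) :
    dualMul f φ b = φ (proj k B 0 (lslice B f (comul (R := k) b)) +
      proj k B 1 (parity k B (lslice B f (comul (R := k) (parity k B b))))) := by
  rw [parity_lslice, ← lslice_signTwist]
  have : LinearMap.mul' k k ∘ₗ TensorProduct.map f φ = φ ∘ₗ lslice B f :=
    TensorProduct.ext' fun c b => by simp
  exact LinearMap.congr_fun this _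

theorem one_mem_gr : (1 : B) ∈ gr k B 0 := SetLike.GradedOne.one_mem (A := gr k B)

theorem mem_leftIntegrals {φ : Module.Dual k B} :
    φ ∈ leftIntegrals k B ↔ ∀ b, rslice B φ (comul (R := k) b) = φ b • (1 : B) := by
  rw [← proj_eq_iff (one_mem_gr (k := k))]
  constructor
  · intro h b
    refine eq_of_forall_dual (k := k) fun f => ?_
    rw [← dualMul_apply, h f]
    simp [mul_comm]
  · intro h f
    ext b
    rw [dualMul_apply, h b]
    simp [mul_comm]

theorem forall_dualMul_eq_iff {φ : Module.Dual k B} {d : B} (hd : d ∈ gr k B 0) :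
    (∀ f, dualMul φ f = f d • φ) ↔ ∀ b, lslice B φ (comul (R := k) b) = φ b • d := by
  rw [← proj_eq_iff hd]
  constructor
  · intro h b
    refine eq_of_forall_dual (k := k) fun f => ?_
    rw [← dualMul_apply', h f]
    simp [mul_comm]
  · intro h f
    ext b
    rw [dualMul_apply', h b]
    simp [mul_comm]

theorem mem_rightIntegrals {φ : Module.Dual k B} :
    φ ∈ rightIntegrals k B ↔ ∀ b, lslice B φ (comul (R := k) b) = φ b • (1 : B) :=
  forall_dualMul_eq_iff (one_mem_gr (k := k))

end Integrals

/-! ### Eigenvectors for even characters -/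

section Socle

variable {k : Type u} [Field k] {B : Type v} [Ring B] [Algebra k B]

/-- On a left ideal that is minimal among those on which an even character `ε` does not vanish,
homogeneous elements of the kernel of `ε` act nilpotently. -/
theorem exists_pow_mul_eq_zero_of_minimal [Superalgebra k B] [FiniteDimensional k B]
    (h2 : (2 : k) ≠ 0) (hB : IsSupercommutative k B) (ε : B →ₐ[k] k) {I : Ideal B}
    (hI : ∃ x ∈ I, ε x ≠ 0) (hmin : ∀ J : Ideal B, (∃ x ∈ J, ε x ≠ 0) → ¬ J < I)
    {i : ZMod 2} {a : B} (ha : a ∈ gr k B i) (hε : ε a = 0) :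
    ∃ n : ℕ, ∀ x ∈ I, a ^ n * x = 0 := by
  rcases zmod_two_cases i with rfl | rfl
  -- Fitting decomposition for multiplication by `a`: write `1 = u + v` with `a ^ n * u = 0` and `v`
  -- a multiple of `a ^ n`. Since `n > 0`, `ε` kills `v` and `ε u = 1`, so the part of `I` killed by
  -- `a ^ n` still meets the condition on `I` and must be all of it.
  · obtain ⟨n, hc, hn⟩ := ((LinearMap.mulLeft k a).eventually_isCompl_ker_pow_range_pow.and
      (Filter.eventually_gt_atTop 0)).exists
    refine ⟨n, ?_⟩
    obtain ⟨u, hu, v, hv, huv⟩ := Submodule.mem_sup.1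
      (hc.sup_eq_top ▸ Submodule.mem_top : (1 : B) ∈ _)
    rw [LinearMap.mem_ker, LinearMap.pow_mulLeft, LinearMap.mulLeft_apply] at hu
    obtain ⟨w, rfl⟩ := hv
    rw [LinearMap.pow_mulLeft, LinearMap.mulLeft_apply] at huv
    have hpow : a ^ n ∈ gr k B 0 := by
      simpa using SetLike.pow_mem_graded n ha
    let J : Ideal B :=
      { carrier := {x | x ∈ I ∧ a ^ n * x = 0}
        add_mem' := fun {x y} hx hy => ⟨I.add_mem hx.1 hy.1, by rw [mul_add, hx.2, hy.2, add_zero]⟩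
        zero_mem' := ⟨I.zero_mem, mul_zero _⟩
        smul_mem' := fun b x hx => ⟨I.smul_mem b hx.1, by
          rw [smul_eq_mul, ← mul_assoc, hB.even_mul hpow, mul_assoc, hx.2, mul_zero]⟩ }
    have hJI : J ≤ I := fun x hx => hx.1
    obtain ⟨x, hx, hεx⟩ := hI
    have hJ : ∃ x ∈ J, ε x ≠ 0 := by
      refine ⟨u * x, ⟨I.mul_mem_left u hx, by rw [← mul_assoc, hu, zero_mul]⟩, ?_⟩
      have : ε u = 1 := by
        have h := congrArg ε huv
        rw [map_add, map_mul, map_pow, hε, zero_pow hn.ne', zero_mul, add_zero, map_one] at h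
        exact h
      rw [map_mul, this, one_mul]
      exact hεx
    have hEq : J = I := by
      by_contra hne
      exact hmin J hJ (lt_of_le_of_ne hJI hne)
    intro y hy
    rw [← hEq] at hy
    exact hy.2
  -- An odd element satisfies `a * a = -(a * a)`, and 2 is invertible.
  · refine ⟨2, fun x _ => ?_⟩
    have h := hB 1 1 a a ha ha
    rw [neg_one_pow_smul (k := k)] at h
    have h' : (2 : k) • (a * a) = 0 := by
      rw [two_smul]
      nth_rw 1 [h]
      simp
    rw [pow_two, (smul_eq_zero.1 h').resolve_left h2, zero_mul]

/-- A finite-dimensional supercommutative superalgebra contains an eigenvector for each of its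
even characters. -/
theorem exists_eigenvector [Superalgebra k B] [FiniteDimensional k B]
    (h2 : (2 : k) ≠ 0) (hB : IsSupercommutative k B) (ε : B →ₐ[k] k)
    (hε : ∀ b ∈ gr k B 1, ε b = 0) : ∃ x : B, x ≠ 0 ∧ ∀ a, a * x = ε a • x := by
  have : IsArtinianRing B := IsArtinianRing.of_finite k B
  obtain ⟨I, hI, hmin⟩ := (wellFounded_lt (α := Ideal B)).has_min {I | ∃ x ∈ I, ε x ≠ 0}
    ⟨⊤, 1, Submodule.mem_top, by simp⟩
  have hI0 : I ≠ ⊥ := by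
    rintro rfl
    obtain ⟨x, hx, hx'⟩ := hI
    rw [Ideal.mem_bot.1 hx, map_zero] at hx'
    exact hx' rfl
  -- Passing to `I` isolates the local part of `B` at `ε`. A minimal nonzero ideal `L` inside it is
  -- killed by every homogeneous element of the kernel of `ε`, as such an element acts nilpotently
  -- and its annihilator in `L` is a nonzero ideal.
  obtain ⟨L, ⟨hLI, hL0⟩, hLmin⟩ := (wellFounded_lt (α := Ideal B)).has_min {L | L ≤ I ∧ L ≠ ⊥}
    ⟨I, le_rfl, hI0⟩
  have key (i : ZMod 2) (a : B) (ha : a ∈ gr k B i) (hεa : ε a = 0) (x : B) (hx : x ∈ L) :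
      a * x = 0 := by
    obtain ⟨n, hn⟩ := exists_pow_mul_eq_zero_of_minimal h2 hB ε hI hmin ha hεa
    let K : Ideal B :=
      { carrier := {x | x ∈ L ∧ a * x = 0}
        add_mem' := fun {x y} hx hy => ⟨L.add_mem hx.1 hy.1, by rw [mul_add, hx.2, hy.2, add_zero]⟩
        zero_mem' := ⟨L.zero_mem, mul_zero _⟩
        smul_mem' := fun b x hx => ⟨L.smul_mem b hx.1, by
          rcases zmod_two_cases i with rfl | rfl
          · rw [smul_eq_mul, ← mul_assoc, hB.even_mul ha, mul_assoc, hx.2, mul_zero]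
          · have := hB.mul_odd ha (parity k B b)
            rw [parity_parity] at this
            rw [smul_eq_mul, ← mul_assoc, ← this, mul_assoc, hx.2, mul_zero]⟩ }
    have hKL : K ≤ L := fun x hx => hx.1
    have hK0 : K ≠ ⊥ := by
      obtain ⟨y, hy, hy0⟩ := Submodule.exists_mem_ne_zero_of_ne_bot hL0
      classical
      -- The last nonzero term of `y, a * y, a ^ 2 * y, …` is a nonzero element of `K`.
      have hex : ∃ m : ℕ, a ^ m * y = 0 := ⟨n, hn y (hLI hy)⟩
      have hm := Nat.find_spec hex
      have hm' := fun m => Nat.find_min hex (m := m)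
      generalize Nat.find hex = m at hm hm'
      cases m with
      | zero => simp [hy0] at hm
      | succ m =>
        intro hK
        have hmem : a ^ m * y ∈ K := ⟨L.mul_mem_left _ hy, by rw [← mul_assoc, ← pow_succ', hm]⟩
        rw [hK] at hmem
        exact hm' m (Nat.lt_succ_self m) hmem
    have hEq : K = L := by
      by_contra hne
      exact hLmin K ⟨hKL.trans hLI, hK0⟩ (lt_of_le_of_ne hKL hne)
    rw [← hEq] at hx
    exact hx.2
  obtain ⟨x, hx, hx0⟩ := Submodule.exists_mem_ne_zero_of_ne_bot hL0
  refine ⟨x, hx0, fun a => ?_⟩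
  have h1 : proj k B 1 a * x = 0 := key 1 _ (proj_mem 1 a) (hε _ (proj_mem 1 a)) x hx
  have h0 : (proj k B 0 a - algebraMap k B (ε a)) * x = 0 := by
    refine key 0 _ (Submodule.sub_mem _ (proj_mem 0 a) ?_) ?_ x hx
    · rw [Algebra.algebraMap_eq_smul_one]
      exact Submodule.smul_mem _ _ (SetLike.GradedOne.one_mem (A := gr k B))
    · nth_rw 2 [← proj_zero_add_proj_one (k := k) a]
      rw [map_add, hε _ (proj_mem 1 a)]
      simp
  nth_rw 1 [← proj_zero_add_proj_one (k := k) a]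
  rw [sub_mul, sub_eq_zero] at h0
  rw [add_mul, h1, h0, add_zero, Algebra.smul_def]

end Socle

/-! ### The Frobenius property and uniqueness of integrals -/

section Frobenius

open WithConv

variable {k : Type u} [Field k] {B : Type v} [Ring B] [Algebra k B] [HopfSuperalgebra k B]

/-- A finite-dimensional supercommutative Hopf superalgebra contains a non-zero homogeneous
integral. -/
theorem exists_integral [FiniteDimensional k B] [NeZero (2 : k)] (hB : IsSupercommutative k B) :
    ∃ x : B, x ≠ 0 ∧ (∃ i, x ∈ gr k B i) ∧ ∀ a, a * x = counit (R := k) a • x := by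
  obtain ⟨x, hx0, hx⟩ := exists_eigenvector (NeZero.ne (2 : k)) hB (counitHom k B)
    HopfSuperalgebra.counit_odd
  have hpx (a : B) : a * parity k B x = counit (R := k) a • parity k B x := by
    have h := congrArg (parity k B) (hx (parity k B a))
    rwa [parity_mul, parity_parity, map_smul, counitHom_apply, counit_parity] at h
  -- The parity image of `x` is also an integral, so either `x` is odd or its symmetrisation is a
  -- nonzero even integral.
  by_cases h : x + parity k B x = 0
  · refine ⟨x, hx0, ⟨1, ?_⟩, hx⟩
    rw [mem_gr_iff, sgn_one, neg_one_smul, eq_neg_iff_add_eq_zero, add_comm, h]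
  · refine ⟨x + parity k B x, h, ⟨0, ?_⟩, fun a => ?_⟩
    · rw [mem_gr_iff, map_add, parity_parity, sgn_zero, one_smul, add_comm]
    · rw [mul_add, hx, hpx, smul_add, counitHom_apply]

/-- The map `g ↦ ∑ Λ₁ g(Λ₂)`. -/
def frobeniusMap (Λ : B) : Module.Dual k B →ₗ[k] B where
  toFun g := rslice B g (comul (R := k) Λ)
  map_add' f g := by simp [rslice, LinearMap.lTensor_add]
  map_smul' c g := by simp [rslice, LinearMap.lTensor_smul]

theorem frobeniusMap_apply (Λ : B) (g : Module.Dual k B) :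
    frobeniusMap Λ g = rslice B g (comul (R := k) Λ) := rfl

theorem mulLeft_comp_conv {R : Type v} [Ring R] [Algebra k R] (x : R) (f g : B →ₗ[k] R) :
    toConv (LinearMap.mulLeft k x ∘ₗ (toConv f * toConv g).ofConv) =
      toConv (LinearMap.mulLeft k x ∘ₗ f) * toConv g := by
  have h : LinearMap.mulLeft k x ∘ₗ LinearMap.mul' k R ∘ₗ TensorProduct.map f g =
      LinearMap.mul' k R ∘ₗ TensorProduct.map (LinearMap.mulLeft k x ∘ₗ f) g :=
    TensorProduct.ext' fun a b => by simp [mul_assoc]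
  ext a
  exact LinearMap.congr_fun h _

variable {Λ : B}

/-- Write `b ⊗ 1` as `∑ Δ(b₁) (1 ⊗ S(b₂))` and absorb `Δ(b₁)` using `Δ(Λ) Δ(b₁) = ε(b₁) Δ(Λ)`. -/
theorem comulHom_mul_inl (hΛ : ∀ a, Λ * a = counit (R := k) a • Λ) (b : B) :
    comulHom k B Λ * inl k B B b = comulHom k B Λ * inr k B B (antipode (k := k) b) := by
  have h1 : toConv (inl k B B).toLinearMap =
      toConv (comulHom k B).toLinearMap *
        toConv ((inr k B B).toLinearMap ∘ₗ antipode (k := k)) := by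
    rw [comulHom_eq, mul_assoc, mul_comp_antipode, mul_one]
  have h2 : LinearMap.mulLeft k (comulHom k B Λ) ∘ₗ (comulHom k B).toLinearMap =
      LinearMap.mulLeft k (comulHom k B Λ) ∘ₗ
        (1 : WithConv (B →ₗ[k] SuperTensor k B B)).ofConv := by
    ext a
    simp only [LinearMap.comp_apply, LinearMap.mulLeft_apply, AlgHom.toLinearMap_apply]
    rw [← map_mul, hΛ, map_smul]
    change _ = comulHom k B Λ * algebraMap k _ (counit a)
    rw [Algebra.smul_def, Algebra.commutes]
  have h3 := mulLeft_comp_conv (comulHom k B Λ) (comulHom k B).toLinearMap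
    ((inr k B B).toLinearMap ∘ₗ antipode (k := k))
  have h4 := mulLeft_comp_conv (comulHom k B Λ) (1 : WithConv (B →ₗ[k] SuperTensor k B B)).ofConv
    ((inr k B B).toLinearMap ∘ₗ antipode (k := k))
  rw [h2, ← h4, ← h1, WithConv.toConv_ofConv, one_mul] at h3
  exact LinearMap.congr_fun (congrArg ofConv h3) b

theorem rslice_inl_mul (g : Module.Dual k B) (b : B) (x : SuperTensor k B B) :
    rslice B g ((ofT k B B).symm (inl k B B b * x)) =
      b * rslice B g ((ofT k B B).symm x) := by
  have : rslice B g ∘ₗ (ofT k B B).symm.toLinearMap ∘ₗ LinearMap.mulLeft k (inl k B B b) =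
      LinearMap.mulLeft k b ∘ₗ rslice B g ∘ₗ (ofT k B B).symm.toLinearMap := by
    refine superTensor_ext fun c d => ?_
    simp only [LinearMap.comp_apply, LinearMap.mulLeft_apply, LinearEquiv.coe_coe]
    rw [← mul_assoc, ← map_mul, inl_mul_inr, inl_mul_inr]
    simp
  exact LinearMap.congr_fun this x

theorem rslice_mul_inr (g : Module.Dual k B) (b : B) (x : SuperTensor k B B) :
    rslice B g ((ofT k B B).symm (x * inr k B B b)) =
      rslice B (g ∘ₗ LinearMap.mulRight k b) ((ofT k B B).symm x) := by
  have : rslice B g ∘ₗ (ofT k B B).symm.toLinearMap ∘ₗ LinearMap.mulRight k (inr k B B b) =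
      rslice B (g ∘ₗ LinearMap.mulRight k b) ∘ₗ (ofT k B B).symm.toLinearMap := by
    refine superTensor_ext fun c d => ?_
    simp only [LinearMap.comp_apply, LinearMap.mulRight_apply, LinearEquiv.coe_coe]
    rw [mul_assoc, ← map_mul, inl_mul_inr, inl_mul_inr]
    simp
  exact LinearMap.congr_fun this x

/-- A homogeneous factor on the first leg moves past `Δ(Λ)` up to sign, then crosses to the second
leg by `comulHom_mul_inl`, where the functional absorbs it. -/
theorem mul_frobeniusMap_mem [NeZero (2 : k)] (hB : IsSupercommutative k B)
    (hΛ : ∀ a, Λ * a = counit (R := k) a • Λ) {i : ZMod 2} (hi : Λ ∈ gr k B i)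
    (b : B) (g : Module.Dual k B) :
    b * frobeniusMap Λ g ∈ LinearMap.range (frobeniusMap (k := k) Λ) := by
  have key (j : ZMod 2) (c : B) (hc : c ∈ gr k B j) :
      c * frobeniusMap Λ g ∈ LinearMap.range (frobeniusMap (k := k) Λ) := by
    have h1 : c * frobeniusMap Λ g =
        rslice B g ((ofT k B B).symm (inl k B B c * comulHom k B Λ)) := by
      rw [rslice_inl_mul]
      rfl
    have h2 : rslice B g ((ofT k B B).symm (comulHom k B Λ * inl k B B c)) =
        frobeniusMap Λ (g ∘ₗ LinearMap.mulRight k (antipode (k := k) c)) := by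
      rw [comulHom_mul_inl hΛ, rslice_mul_inr]
      rfl
    rw [h1, hB.superTensor hB j i _ _ (isSuperHom_inl j c hc) (isSuperHom_comulHom i Λ hi),
      neg_one_pow_smul (k := k)]
    split_ifs
    · rw [map_neg, map_neg, h2]
      exact Submodule.neg_mem _ ⟨_, rfl⟩
    · rw [h2]
      exact ⟨_, rfl⟩
  rw [← proj_zero_add_proj_one (k := k) b, add_mul]
  exact Submodule.add_mem _ (key 0 _ (proj_mem 0 b)) (key 1 _ (proj_mem 1 b))

/-- The range is stable under parity because `Λ` is homogeneous, so right multiplication reduces to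
left multiplication by supercommutativity. -/
theorem frobeniusMap_mul_mem [NeZero (2 : k)] (hB : IsSupercommutative k B)
    (hΛ : ∀ a, Λ * a = counit (R := k) a • Λ) {i : ZMod 2} (hi : Λ ∈ gr k B i)
    (b : B) (g : Module.Dual k B) :
    frobeniusMap Λ g * b ∈ LinearMap.range (frobeniusMap (k := k) Λ) := by
  have hpar : parity k B (frobeniusMap Λ g) =
      frobeniusMap Λ (sgn k i • (g ∘ₗ parity k B)) := by
    have h := parity_rslice g (parity k B Λ)
    rw [parity_parity, parity_of_mem hi, map_smul, map_smul] at h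
    rw [map_smul]
    exact h
  rw [hB.mul_eq, hpar]
  exact Submodule.add_mem _ (mul_frobeniusMap_mem hB hΛ hi _ _)
    (mul_frobeniusMap_mem hB hΛ hi _ _)

/-- The range is a two-sided ideal closed under slicing. For `y` in it, `∑ y₁ S(y₂) = ε(y) 1`
therefore lies in it; choosing `y` as the image of some `g` with `g Λ ≠ 0` gives `ε(y) ≠ 0`, so the
range contains `1`. -/
theorem frobeniusMap_surjective [FiniteDimensional k B] [NeZero (2 : k)]
    (hB : IsSupercommutative k B)
    (hΛ : ∀ a, Λ * a = counit (R := k) a • Λ) {i : ZMod 2} (hi : Λ ∈ gr k B i) (h0 : Λ ≠ 0) :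
    Function.Surjective (frobeniusMap (k := k) Λ) := by
  obtain ⟨g, hg⟩ : ∃ g : Module.Dual k B, g Λ ≠ 0 := by
    by_contra! h
    exact h0 ((Module.forall_dual_apply_eq_zero_iff k Λ).1 h)
  have h1 : LinearMap.mul' k B ((antipode (k := k)).lTensor B
      (comul (R := k) (frobeniusMap Λ g))) ∈ LinearMap.range (frobeniusMap (k := k) Λ) := by
    have := lift_mem_of_rslice_mem (V := LinearMap.range (frobeniusMap (k := k) Λ))
      (W := LinearMap.range (frobeniusMap (k := k) Λ))
      ((LinearMap.mul k B).compl₂ (antipode (k := k)))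
      (by
        rintro _ ⟨f, rfl⟩ b
        exact frobeniusMap_mul_mem hB hΛ hi _ f)
      (comul (R := k) (frobeniusMap Λ g))
      (fun f => ⟨conv f g, rslice_conv f g Λ⟩)
    have e : TensorProduct.lift ((LinearMap.mul k B).compl₂ (antipode (k := k))) =
        LinearMap.mul' k B ∘ₗ (antipode (k := k)).lTensor B :=
      TensorProduct.ext' fun a b => by simp
    rwa [e] at this
  have h2 := LinearMap.congr_fun
    (HopfSuperalgebra.mul_antipode_lTensor_comul (k := k) (A := B)) (frobeniusMap Λ g)
  simp only [LinearMap.comp_apply] at h2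
  rw [h2, frobeniusMap_apply, counit_rslice, Algebra.linearMap_apply,
    Algebra.algebraMap_eq_smul_one] at h1
  obtain ⟨f, hf⟩ := (Submodule.smul_mem_iff _ hg).1 h1
  intro b
  obtain ⟨f', hf'⟩ := mul_frobeniusMap_mem hB hΛ hi b f
  exact ⟨f', by rw [hf', hf, mul_one]⟩

/-- In a finite-dimensional supercommutative Hopf superalgebra some element makes
`frobeniusMap` bijective. -/
theorem exists_frobenius [FiniteDimensional k B] [NeZero (2 : k)] (hB : IsSupercommutative k B) :
    ∃ Λ : B, Function.Bijective (frobeniusMap (k := k) Λ) := by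
  obtain ⟨Λ, h0, ⟨i, hi⟩, hΛ⟩ := exists_integral hB
  have hΛ' (a : B) : Λ * a = counit (R := k) a • Λ := by
    have h1 : counit (R := k) (proj k B 1 a) = 0 :=
      HopfSuperalgebra.counit_odd _ (proj_mem 1 a)
    rw [hB.mul_eq, parity_of_mem hi, mul_smul_comm, hΛ, hΛ, h1, zero_smul, smul_zero, add_zero]
    nth_rw 2 [← proj_zero_add_proj_one (k := k) a]
    rw [map_add, h1, add_zero]
  have hs := frobeniusMap_surjective hB hΛ' hi h0
  exact ⟨Λ, (LinearMap.injective_iff_surjective_of_finrank_eq_finrank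
    Subspace.dual_finrank_eq).2 hs, hs⟩

/-- The space of left integrals is spanned by a single functional, and any right integral is
determined by its value on a fixed element. -/
theorem exists_leftIntegral [FiniteDimensional k B] [NeZero (2 : k)]
    (hB : IsSupercommutative k B) :
    ∃ (φ : Module.Dual k B) (Λ : B), φ ∈ leftIntegrals k B ∧ φ Λ = 1 ∧
      (∀ f ∈ leftIntegrals k B, f = f Λ • φ) ∧
      ∀ f ∈ rightIntegrals k B, f Λ = 0 → f = 0 := by
  obtain ⟨Λ, hinj, hsurj⟩ := exists_frobenius (k := k) hB
  -- A left integral `f` has image `f Λ • 1`, which leaves only multiples of this preimage of `1`.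
  obtain ⟨φ, hφ⟩ := hsurj 1
  have hval (f : Module.Dual k B) (hf : f ∈ leftIntegrals k B) :
      frobeniusMap Λ f = f Λ • (1 : B) := mem_leftIntegrals.1 hf Λ
  have hφI : φ ∈ leftIntegrals k B := by
    rw [mem_leftIntegrals]
    intro b
    refine eq_of_forall_dual (k := k) fun f => ?_
    have h : conv f φ = f 1 • φ := by
      refine hinj ?_
      rw [map_smul, hφ, frobeniusMap_apply, rslice_conv, ← frobeniusMap_apply Λ φ, hφ,
        HopfSuperalgebra.comul_one, rslice_tmul]
    rw [← conv_apply, h]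
    simp [mul_comm]
  have h1 : (1 : B) ≠ 0 := by
    intro h
    have := HopfSuperalgebra.counit_one (k := k) (A := B)
    rw [h, map_zero] at this
    exact zero_ne_one this
  have hφΛ : φ Λ = 1 := by
    have h := hval φ hφI
    rw [hφ] at h
    have h' : (φ Λ - 1) • (1 : B) = 0 := by rw [sub_smul, ← h, one_smul, sub_self]
    exact sub_eq_zero.1 ((smul_eq_zero.1 h').resolve_right h1)
  refine ⟨φ, Λ, hφI, hφΛ, fun f hf => hinj ?_, fun f hf hfΛ => ?_⟩
  · rw [hval f hf, map_smul, hφ]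
  -- Every `b` is `∑ Λ₁ g(Λ₂)`, and right invariance gives `f b = f Λ * g 1`.
  · ext b
    obtain ⟨g, rfl⟩ := hsurj b
    rw [frobeniusMap_apply, apply_rslice, mem_rightIntegrals.1 hf, hfΛ, zero_smul, map_zero]
    rfl

end Frobenius

/-! ### The distinguished group-like element -/

section Distinguished

variable {k : Type u} [Field k] {B : Type v} [Ring B] [Algebra k B] [HopfSuperalgebra k B]

theorem conv_assoc (f g h : Module.Dual k B) : conv (conv f g) h = conv f (conv g h) := by
  ext b
  rw [conv_apply (conv f g), conv_apply f g, conv_apply f (conv g h), rslice_conv]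

theorem conv_mem_leftIntegrals {φ : Module.Dual k B} (hφ : φ ∈ leftIntegrals k B)
    (f : Module.Dual k B) : conv φ f ∈ leftIntegrals k B := by
  rw [mem_leftIntegrals] at *
  intro b
  rw [rslice_conv, hφ, conv_apply]

theorem comp_parity_mem_leftIntegrals {φ : Module.Dual k B} (hφ : φ ∈ leftIntegrals k B) :
    φ ∘ₗ parity k B ∈ leftIntegrals k B := by
  rw [mem_leftIntegrals] at *
  intro b
  rw [← parity_rslice, hφ, map_smul, parity_one, LinearMap.comp_apply]

/-- Parity acts on the line of left integrals by a scalar whose square is `1`; thus `φ` is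
homogeneous. -/
theorem exists_sgn_of_unique {φ : Module.Dual k B} {Λ : B} (hφ : φ ∈ leftIntegrals k B)
    (h1 : φ Λ = 1) (hu : ∀ f ∈ leftIntegrals k B, f = f Λ • φ) :
    ∃ q : ZMod 2, φ ∘ₗ parity k B = sgn k q • φ := by
  have h := hu _ (comp_parity_mem_leftIntegrals hφ)
  rw [LinearMap.comp_apply] at h
  have h2 := LinearMap.congr_fun h (parity k B Λ)
  rw [LinearMap.comp_apply, parity_parity, h1, LinearMap.smul_apply, smul_eq_mul, eq_comm,
    mul_self_eq_one_iff] at h2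
  rcases h2 with h2 | h2
  · exact ⟨0, by rw [h, h2, sgn_zero]⟩
  · exact ⟨1, by rw [h, h2, sgn_one]⟩

theorem sgn_smul_cancel {M : Type*} [AddCommGroup M] [Module k M] {q : ZMod 2} {x y : M}
    (h : sgn k q • x = sgn k q • y) : x = y := by
  have := congrArg (sgn k q • ·) h
  simpa [smul_smul, sgn_mul_self] using this

/-- Right convolution by `f` scales `φ` by `f d`, where `d` is the slice of `Δ(Λ)` by `φ`.
Associativity makes `f ↦ f d` multiplicative for unsigned convolution, which is group-likeness of
`d`; homogeneity of `φ` makes `d` even. -/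
theorem exists_groupLike [FiniteDimensional k B] [NeZero (2 : k)] {φ : Module.Dual k B} {Λ : B}
    (hφ : φ ∈ leftIntegrals k B)
    (h1 : φ Λ = 1) (hu : ∀ f ∈ leftIntegrals k B, f = f Λ • φ) :
    ∃ d : B, IsGroupLike k d ∧ ∀ b, lslice B φ (comul (R := k) b) = φ b • d := by
  have hconv (f : Module.Dual k B) : conv φ f = f (lslice B φ (comul (R := k) Λ)) • φ := by
    rw [← conv_apply']
    exact hu _ (conv_mem_leftIntegrals hφ f)
  have hd (b : B) : lslice B φ (comul (R := k) b) = φ b • lslice B φ (comul (R := k) Λ) := by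
    refine eq_of_forall_dual (k := k) fun f => ?_
    rw [← conv_apply', hconv]
    simp [mul_comm]
  refine ⟨lslice B φ (comul (R := k) Λ), ⟨?_, ?_, ?_⟩, hd⟩
  · intro h
    have := counit_lslice φ Λ
    rw [h, map_zero, h1] at this
    exact zero_ne_one this
  · obtain ⟨q, hq⟩ := exists_sgn_of_unique hφ h1 hu
    have h := parity_lslice φ Λ
    have hq' : φ (parity k B Λ) = sgn k q := by
      have := LinearMap.congr_fun hq Λ
      simpa [h1] using this
    rw [hd (parity k B Λ), hq, hq', lslice_smul, map_smul, LinearMap.smul_apply] at h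
    rw [mem_gr_iff, sgn_zero, one_smul]
    exact sgn_smul_cancel h
  · refine tensor_ext_rslice fun g => eq_of_forall_dual (k := k) fun f => ?_
    have h := LinearMap.congr_fun (conv_assoc φ f g) Λ
    rw [conv_apply' φ, hconv f] at h
    rw [← conv_apply, ← h, rslice_tmul, map_smul, conv_apply', lslice_smul, LinearMap.smul_apply,
      map_smul, smul_eq_mul, smul_eq_mul, mul_comm]

theorem IsGroupLike.counit_eq_one {d : B} (hd : IsGroupLike k d) : counit (R := k) d = 1 := by
  have h := Coalgebra.rTensor_counit_comul (R := k) d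
  rw [hd.2.2] at h
  have h' := congrArg (TensorProduct.lid k B) h
  simp only [LinearMap.rTensor_tmul, TensorProduct.lid_tmul, one_smul] at h'
  have h'' : (counit (R := k) d - 1) • d = 0 := by rw [sub_smul, h', one_smul, sub_self]
  exact sub_eq_zero.1 ((smul_eq_zero.1 h'').resolve_right hd.1)

theorem IsGroupLike.antipode_mul {d : B} (hd : IsGroupLike k d) :
    antipode (k := k) d * d = 1 := by
  have h := LinearMap.congr_fun (HopfSuperalgebra.mul_antipode_rTensor_comul (k := k) (A := B)) d
  simpa [hd.2.2, hd.counit_eq_one] using h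

theorem IsGroupLike.mul_antipode {d : B} (hd : IsGroupLike k d) :
    d * antipode (k := k) d = 1 := by
  have h := LinearMap.congr_fun (HopfSuperalgebra.mul_antipode_lTensor_comul (k := k) (A := B)) d
  simpa [hd.2.2, hd.counit_eq_one] using h

end Distinguished

/-! ### Functionals as algebra-valued maps -/

section ScalarMap

variable {k : Type u} [Field k] {A : Type v} [Ring A] [Algebra k A]
variable {R : Type*} [Ring R] [Algebra k R]

variable (R) in
/-- A functional, regarded as a map with scalar values in an algebra. -/
def scalarMap (ψ : Module.Dual k A) : A →ₗ[k] R := Algebra.linearMap k R ∘ₗ ψ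

theorem scalarMap_apply (ψ : Module.Dual k A) (a : A) :
    scalarMap R ψ a = algebraMap k R (ψ a) := rfl

theorem comp_scalarMap {R' : Type*} [Ring R'] [Algebra k R'] (F : R →ₐ[k] R')
    (ψ : Module.Dual k A) : F.toLinearMap ∘ₗ scalarMap R ψ = scalarMap R' ψ := by
  ext a
  simp [scalarMap]

end ScalarMap

/-! ### The coadjoint coaction as a convolution product -/

section Coadjoint

open WithConv

variable {k : Type u} [Field k]
variable {A : Type v} [Ring A] [Algebra k A] [HopfSuperalgebra k A]
variable {B : Type v} [Ring B] [Algebra k B] [HopfSuperalgebra k B]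
variable {R : Type*} [Ring R] [Algebra k R]

/-- Any `F` that turns left multiplication on the first leg into multiplication through `l` lets the
factor `a₁` split off. This covers both the passage to `A ⊗ B` and slicing by a functional. -/
theorem apply_coad (F : A ⊗[k] A →ₗ[k] R) (l : A →ₗ[k] R)
    (hF : ∀ a b c, F ((a * b) ⊗ₜ c) = l a * F (b ⊗ₜ c)) (a : A) :
    F (coad k A a) = (toConv l * toConv (F ∘ₗ (antipode (k := k) (A := A)).rTensor A ∘ₗ
      (TensorProduct.comm k A A).toLinearMap ∘ₗ signTwist k A ∘ₗ comul)).ofConv a := by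
  have h : F ∘ₗ (LinearMap.mul' k A).rTensor A ∘ₗ
      (TensorProduct.assoc k A A A).symm.toLinearMap =
      LinearMap.mul' k R ∘ₗ TensorProduct.map l F := by
    refine TensorProduct.ext' fun a x => ?_
    have h' : F ∘ₗ (LinearMap.mul' k A).rTensor A ∘ₗ
      (TensorProduct.assoc k A A A).symm.toLinearMap ∘ₗ TensorProduct.mk k A (A ⊗[k] A) a =
      LinearMap.mulLeft k (l a) ∘ₗ F := TensorProduct.ext' fun b c => by simp [hF]
    simpa using LinearMap.congr_fun h' x
  have h2 (Y : A →ₗ[k] A ⊗[k] A) : TensorProduct.map l (F ∘ₗ Y) =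
      TensorProduct.map l F ∘ₗ Y.lTensor A :=
    TensorProduct.ext' fun b c => by simp
  have h3 := LinearMap.congr_fun h (((antipode (k := k) (A := A)).rTensor A ∘ₗ
    (TensorProduct.comm k A A).toLinearMap ∘ₗ signTwist k A ∘ₗ comul).lTensor A
      (comul (R := k) a))
  refine h3.trans ?_
  change _ = LinearMap.mul' k R (TensorProduct.map l (F ∘ₗ _) _)
  rw [h2]
  rfl

/-- The coadjoint coaction, expressed by points: it represents `(g, n) ↦ g n g⁻¹`. -/
theorem lTensor_coad {π : A →ₐ[k] B} (hπ : IsSuperHom π) (a : A) :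
    ofT k A B (π.toLinearMap.lTensor A (coad k A a)) =
      (toConv (inl k A B).toLinearMap * (toConv ((inr k A B).toLinearMap ∘ₗ π.toLinearMap) *
        toConv ((inl k A B).toLinearMap ∘ₗ antipode (k := k)))).ofConv a := by
  have hF (a b c : A) : ((ofT k A B).toLinearMap ∘ₗ π.toLinearMap.lTensor A) ((a * b) ⊗ₜ c) =
      (inl k A B).toLinearMap a *
        ((ofT k A B).toLinearMap ∘ₗ π.toLinearMap.lTensor A) (b ⊗ₜ c) := by
    simp only [LinearMap.comp_apply, LinearMap.lTensor_tmul, LinearEquiv.coe_coe,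
      AlgHom.toLinearMap_apply]
    rw [← inl_mul_inr, ← inl_mul_inr, map_mul, mul_assoc]
  refine (apply_coad ((ofT k A B).toLinearMap ∘ₗ π.toLinearMap.lTensor A) _ hF a).trans ?_
  congr 3
  have h : ((ofT k A B).toLinearMap ∘ₗ π.toLinearMap.lTensor A) ∘ₗ
      (antipode (k := k) (A := A)).rTensor A ∘ₗ
      (TensorProduct.comm k A A).toLinearMap ∘ₗ signTwist k A =
      LinearMap.mul' k (SuperTensor k A B) ∘ₗ
        TensorProduct.map ((inr k A B).toLinearMap ∘ₗ π.toLinearMap)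
          ((inl k A B).toLinearMap ∘ₗ antipode (k := k)) := by
    refine TensorProduct.ext' fun b c => ?_
    simp only [LinearMap.comp_apply, TensorProduct.map_tmul, LinearMap.mul'_apply,
      AlgHom.toLinearMap_apply]
    rw [inr_mul_inl', ← hπ.proj, ← hπ.proj, ← antipode_parity]
    simp [signTwist]
  ext b
  exact LinearMap.congr_fun h (comul (R := k) b)

variable (k A) in
/-- The power `parity ^ q` as a homomorphism of algebras. -/
def parityPow (q : ZMod 2) : A →ₐ[k] A := if q = 0 then AlgHom.id k A else parityHom k A

theorem parityPow_zero (a : A) : parityPow k A 0 a = a := rfl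

theorem parityPow_one (a : A) : parityPow k A 1 a = parity k A a := rfl

theorem parityPow_parity (q : ZMod 2) (a : A) :
    parityPow k A q (parity k A a) = parity k A (parityPow k A q a) := by
  rcases zmod_two_cases q with rfl | rfl <;> rfl

theorem map_parityPow {π : A →ₐ[k] B} (hπ : IsSuperHom π) (q : ZMod 2) (a : A) :
    π (parityPow k A q a) = parityPow k B q (π a) := by
  rcases zmod_two_cases q with rfl | rfl
  · rfl
  · exact hπ.parity a

theorem counit_parityPow (q : ZMod 2) (a : A) :
    counit (R := k) (parityPow k A q a) = counit (R := k) a := by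
  rcases zmod_two_cases q with rfl | rfl
  · rfl
  · exact counit_parity a

theorem parityPow_of_even (q : ZMod 2) {a : A} (ha : a ∈ gr k A 0) : parityPow k A q a = a := by
  rcases zmod_two_cases q with rfl | rfl
  · rfl
  · rw [parityPow_one, parity_of_mem ha, sgn_zero, one_smul]

variable (k A) in
/-- The antipode twisted by a power of the parity automorphism. -/
def twistedAntipode (q : ZMod 2) : A →ₗ[k] A := antipode (k := k) ∘ₗ (parityPow k A q).toLinearMap

theorem twistedAntipode_apply (q : ZMod 2) (a : A) :
    twistedAntipode k A q a = antipode (k := k) (parityPow k A q a) := rfl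

variable (k A) in
/-- The conjugate `g ψ g⁻¹` of a homogeneous functional by the universal point. -/
def conjFunctional (ψ : Module.Dual k A) (q : ZMod 2) : WithConv (A →ₗ[k] A) :=
  toConv LinearMap.id * (toConv (scalarMap A ψ) * toConv (twistedAntipode k A q))

theorem comp_conjFunctional (F : A →ₐ[k] R) (ψ : Module.Dual k A) (q : ZMod 2) :
    toConv (F.toLinearMap ∘ₗ (conjFunctional k A ψ q).ofConv) =
      toConv F.toLinearMap * (toConv (scalarMap R ψ) *
        toConv (F.toLinearMap ∘ₗ twistedAntipode k A q)) := by
  have h := algHom_comp_conv_mul F LinearMap.id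
    (toConv (scalarMap A ψ) * toConv (twistedAntipode k A q)).ofConv
  rw [WithConv.toConv_ofConv, algHom_comp_conv_mul F (scalarMap A ψ) (twistedAntipode k A q),
    comp_scalarMap] at h
  exact h

/-- As `ψ` sees only the component of parity `q`, the sign `(-1)^(|a₂||a₃|)` becomes `(-1)^(q|a₃|)`,
which is absorbed by twisting the antipode. -/
theorem rslice_coad [NeZero (2 : k)] {ψ : Module.Dual k A} {q : ZMod 2}
    (hψ : ψ ∘ₗ parity k A = sgn k q • ψ) (a : A) :
    rslice A ψ (coad k A a) = (conjFunctional k A ψ q).ofConv a := by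
  have h2 : (2 : k) ≠ 0 := NeZero.ne 2
  refine (apply_coad (rslice A ψ) LinearMap.id (fun a b c => by simp) a).trans ?_
  rw [conjFunctional]
  congr 3
  have h : rslice A ψ ∘ₗ (antipode (k := k) (A := A)).rTensor A ∘ₗ
      (TensorProduct.comm k A A).toLinearMap ∘ₗ signTwist k A =
      LinearMap.mul' k A ∘ₗ TensorProduct.map (scalarMap A ψ) (twistedAntipode k A q) := by
    refine TensorProduct.ext' fun b c => ?_
    have hb := congrArg ψ (two_smul_proj_zero (k := k) b)
    have hb' := congrArg ψ (two_smul_proj_one (k := k) b)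
    have hp : ψ (parity k A b) = sgn k q * ψ b := LinearMap.congr_fun hψ b
    rw [map_smul, map_add, hp, smul_eq_mul] at hb
    rw [map_smul, map_sub, hp, smul_eq_mul] at hb'
    rcases zmod_two_cases q with rfl | rfl
    · have e0 : ψ (proj k A 0 b) = ψ b := mul_left_cancel₀ h2 (by rw [hb, sgn_zero]; ring)
      have e1 : ψ (proj k A 1 b) = 0 := mul_left_cancel₀ h2 (by rw [hb', sgn_zero]; ring)
      simp [signTwist, e0, e1, scalarMap_apply, twistedAntipode_apply, parityPow_zero,
        Algebra.smul_def]
    · have e0 : ψ (proj k A 0 b) = 0 := mul_left_cancel₀ h2 (by rw [hb, sgn_one]; ring)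
      have e1 : ψ (proj k A 1 b) = ψ b := mul_left_cancel₀ h2 (by rw [hb', sgn_one]; ring)
      simp [signTwist, e0, e1, scalarMap_apply, twistedAntipode_apply, parityPow_one,
        Algebra.smul_def]
  ext b
  exact LinearMap.congr_fun h (comul (R := k) b)

end Coadjoint

/-! ### Conjugation by universal points -/

section Conjugation

open WithConv

variable {k : Type u} [Field k]
variable {A : Type v} [Ring A] [Algebra k A] [HopfSuperalgebra k A]
variable {B : Type v} [Ring B] [Algebra k B] [HopfSuperalgebra k B]

theorem IsSupercommutative.of_surjective {π : A →ₐ[k] B} (hA : IsSupercommutative k A)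
    (hπ : IsSuperHom π) (hsurj : Function.Surjective π) : IsSupercommutative k B := by
  intro i j a b ha hb
  obtain ⟨a', rfl⟩ := hsurj a
  obtain ⟨b', rfl⟩ := hsurj b
  rw [← proj_of_mem ha, ← proj_of_mem hb, ← hπ.proj, ← hπ.proj, ← map_mul,
    hA i j _ _ (proj_mem i a') (proj_mem j b'), AlgHom.map_smul_of_tower, map_mul]

/-- For a normal super-subgroup the coadjoint coaction descends. -/
theorem IsNormal.exists_inducedCoad [NeZero (2 : k)] {π : A →ₐ[k] B} (hA : IsSupercommutative k A)
    (hB : IsSupercommutative k B) (hπ : IsSuperHom π) (hN : IsNormal π) :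
    ∃ δ : B →ₗ[k] A ⊗[k] B, IsInducedCoad π δ := by
  -- For the universal pair of points, the homomorphism through which `g n g⁻¹` factors is the
  -- induced coaction itself.
  obtain ⟨n, -, hn⟩ := hN (SuperTensor k A B) (hA.superTensor hB) (inl k A B) (inr k A B)
    isSuperHom_inl isSuperHom_inr
  refine ⟨(ofT k A B).symm.toLinearMap ∘ₗ n.toLinearMap, LinearMap.ext fun a => ?_⟩
  apply (ofT k A B).injective
  have h := lTensor_coad hπ a
  rw [← mul_assoc] at h
  exact ((LinearMap.congr_fun hn a).trans h.symm)

theorem isSuperHom_antipodeHom [NeZero (2 : k)] (hA : IsSupercommutative k A) :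
    IsSuperHom (antipodeHom hA) :=
  fun i a ha => HopfSuperalgebra.antipode_mem i a ha

/-- The point `g⁻¹ n g` of a normal super-subgroup, for universal points `n` and `g`. -/
theorem IsNormal.exists_conj_inv [NeZero (2 : k)] {π : A →ₐ[k] B} (hA : IsSupercommutative k A)
    (hB : IsSupercommutative k B) (hN : IsNormal π) :
    ∃ n : B →ₐ[k] SuperTensor k B A, toConv (n.comp π).toLinearMap =
      toConv ((inr k B A).toLinearMap ∘ₗ antipode (k := k)) *
        toConv ((inl k B A).comp π).toLinearMap * toConv (inr k B A).toLinearMap := by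
  have hg : IsSuperHom ((inr k B A).comp (antipodeHom hA)) := fun i a ha =>
    isSuperHom_inr i _ (isSuperHom_antipodeHom hA i a ha)
  -- Normality is applied to `g⁻¹ = inr ∘ S`; involutivity of the antipode then identifies its
  -- inverse with `inr`.
  obtain ⟨n, -, hn⟩ := hN (SuperTensor k B A) (hB.superTensor hA)
    ((inr k B A).comp (antipodeHom hA)) (inl k B A) hg isSuperHom_inl
  refine ⟨n, ?_⟩
  have h : ((inr k B A).comp (antipodeHom hA)).toLinearMap ∘ₗ antipode (k := k) =
      (inr k B A).toLinearMap :=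
    LinearMap.ext fun a => congrArg (inr k B A) (antipode_antipode hA a)
  rw [h] at hn
  exact congrArg toConv hn

/-- Left invariance of `φ` in terms of points: `n φ = φ` for every algebra-valued point `n` of `B`.
-/
theorem conv_scalarMap_of_leftIntegral {R : Type*} [Ring R] [Algebra k R] {π : A →ₐ[k] B}
    (hπ : IsHopfSuperHom π) {φ : Module.Dual k B} (hφ : φ ∈ leftIntegrals k B) (n : B →ₐ[k] R) :
    toConv (n.comp π).toLinearMap * toConv (scalarMap R (φ ∘ₗ π.toLinearMap)) =
      toConv (scalarMap R (φ ∘ₗ π.toLinearMap)) := by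
  have h : LinearMap.mul' k R ∘ₗ TensorProduct.map (n.comp π).toLinearMap
      (scalarMap R (φ ∘ₗ π.toLinearMap)) =
      n.toLinearMap ∘ₗ rslice B φ ∘ₗ TensorProduct.map π.toLinearMap π.toLinearMap :=
    TensorProduct.ext' fun a b => by
      simp [scalarMap_apply, Algebra.smul_def, Algebra.commutes]
  ext a
  refine (LinearMap.congr_fun h (comul (R := k) a)).trans ?_
  simp only [LinearMap.comp_apply]
  rw [← hπ.map_comul, mem_leftIntegrals.1 hφ]
  simp [scalarMap_apply, Algebra.algebraMap_eq_smul_one]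

/-- The computation `n (g φ g⁻¹) = g (g⁻¹ n g) φ g⁻¹ = g φ g⁻¹`, where normality makes `g⁻¹ n g` a
point of `N`. -/
theorem conjFunctional_invariant [NeZero (2 : k)] {π : A →ₐ[k] B} (hA : IsSupercommutative k A)
    (hB : IsSupercommutative k B) (hπ : IsHopfSuperHom π) (hN : IsNormal π)
    {φ : Module.Dual k B} (hφ : φ ∈ leftIntegrals k B) (q : ZMod 2) :
    toConv ((inl k B A).comp π).toLinearMap *
      toConv ((inr k B A).toLinearMap ∘ₗ (conjFunctional k A (φ ∘ₗ π.toLinearMap) q).ofConv) =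
      toConv ((inr k B A).toLinearMap ∘ₗ
        (conjFunctional k A (φ ∘ₗ π.toLinearMap) q).ofConv) := by
  obtain ⟨n, hn⟩ := hN.exists_conj_inv hA hB
  have hm := conv_scalarMap_of_leftIntegral hπ hφ n
  have h1 : toConv ((inl k B A).comp π).toLinearMap * toConv (inr k B A).toLinearMap =
      toConv (inr k B A).toLinearMap * toConv (n.comp π).toLinearMap := by
    rw [hn, ← mul_assoc, ← mul_assoc, mul_comp_antipode, one_mul]
  rw [comp_conjFunctional, ← mul_assoc, h1, mul_assoc, ← mul_assoc (toConv (n.comp π).toLinearMap),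
    hm]

variable {π : A →ₐ[k] B} {φ : Module.Dual k B} {δ : B →ₗ[k] A ⊗[k] B} {q : ZMod 2}

theorem rslice_inducedCoad [NeZero (2 : k)] (hδ : IsInducedCoad π δ) (hπ : IsSuperHom π)
    (hq : φ ∘ₗ parity k B = sgn k q • φ) (a : A) :
    rslice A φ (δ (π a)) = (conjFunctional k A (φ ∘ₗ π.toLinearMap) q).ofConv a := by
  have hψ : (φ ∘ₗ π.toLinearMap) ∘ₗ parity k A = sgn k q • (φ ∘ₗ π.toLinearMap) := by
    ext b
    simpa [hπ.parity] using LinearMap.congr_fun hq (π b)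
  rw [← rslice_coad hψ]
  have h : rslice A φ ∘ₗ π.toLinearMap.lTensor A = rslice A (φ ∘ₗ π.toLinearMap) :=
    TensorProduct.ext' fun b c => by simp
  rw [← h]
  exact congrArg (rslice A φ) (LinearMap.congr_fun hδ a)

/-- Conjugates of left integrals are left integrals. -/
theorem comp_rslice_mem_leftIntegrals [NeZero (2 : k)] (hA : IsSupercommutative k A)
    (hπ : IsHopfSuperHom π)
    (hsurj : Function.Surjective π) (hN : IsNormal π) (hδ : IsInducedCoad π δ)
    (hφ : φ ∈ leftIntegrals k B) (hq : φ ∘ₗ parity k B = sgn k q • φ) (f : Module.Dual k A) :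
    f ∘ₗ rslice A φ ∘ₗ δ ∈ leftIntegrals k B := by
  have hB := hA.of_surjective hπ.isSuperHom hsurj
  have hT : (rslice A φ ∘ₗ δ) ∘ₗ π.toLinearMap =
      (conjFunctional k A (φ ∘ₗ π.toLinearMap) q).ofConv :=
    LinearMap.ext fun a => rslice_inducedCoad hδ hπ.isSuperHom hq a
  have h := conjFunctional_invariant hA hB hπ hN hφ q
  rw [← hT] at h
  generalize rslice A φ ∘ₗ δ = T at h ⊢
  have hmap : LinearMap.mul' k (SuperTensor k B A) ∘ₗ
      TensorProduct.map ((inl k B A).comp π).toLinearMap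
        ((inr k B A).toLinearMap ∘ₗ T ∘ₗ π.toLinearMap) =
      (ofT k B A).toLinearMap ∘ₗ T.lTensor B ∘ₗ
        TensorProduct.map π.toLinearMap π.toLinearMap :=
    TensorProduct.ext' fun a b => by simp [inl_mul_inr]
  -- Surjectivity of `π` transfers the invariance to `B`: `T` is an `A`-valued left integral, and
  -- `f` extracts a scalar one.
  have hinv (b : B) : T.lTensor B (comul (R := k) b) = (1 : B) ⊗ₜ[k] T b := by
    obtain ⟨a, rfl⟩ := hsurj b
    have h1 := LinearMap.congr_fun hmap (comul (R := k) a)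
    simp only [LinearMap.comp_apply] at h1
    rw [← hπ.map_comul] at h1
    apply (ofT k B A).injective
    refine h1.symm.trans ((LinearMap.congr_fun (congrArg ofConv h) a).trans ?_)
    simpa using inl_mul_inr (k := k) (1 : B) (T (π a))
  rw [mem_leftIntegrals]
  intro b
  have h2 : rslice B (f ∘ₗ T) = rslice B f ∘ₗ T.lTensor B :=
    TensorProduct.ext' fun b c => by simp
  rw [h2, LinearMap.comp_apply, hinv, rslice_tmul, LinearMap.comp_apply]

theorem counit_antipode (a : A) : counit (R := k) (antipode (k := k) a) = counit (R := k) a := by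
  have h := mul_comp_antipode (counitHom k A)
  have h1 : toConv (counitHom k A).toLinearMap = 1 := by
    ext a
    simp
  rw [h1, one_mul] at h
  simpa using LinearMap.congr_fun (congrArg ofConv h) a

theorem counit_conjFunctional (ψ : Module.Dual k A) (q : ZMod 2) (a : A) :
    counit (R := k) ((conjFunctional k A ψ q).ofConv a) = ψ a := by
  have h := comp_conjFunctional (counitHom k A) ψ q
  have h1 : toConv (counitHom k A).toLinearMap = 1 := by
    ext a
    simp
  have h2 : toConv ((counitHom k A).toLinearMap ∘ₗ twistedAntipode k A q) = 1 := by
    ext a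
    simp [twistedAntipode_apply, counit_antipode, counit_parityPow]
  rw [h1, h2, one_mul, mul_one] at h
  exact LinearMap.congr_fun (congrArg ofConv h) a

/-- Parity is a coalgebra map commuting with the two outer factors, while `ψ` contributes the sign.
This yields evenness of `χ`. -/
theorem parity_conjFunctional {ψ : Module.Dual k A} (hψ : ψ ∘ₗ parity k A = sgn k q • ψ) (a : A) :
    (conjFunctional k A ψ q).ofConv (parity k A a) =
      sgn k q • parity k A ((conjFunctional k A ψ q).ofConv a) := by
  have h := congrArg toConv (LinearMap.convMul_comp_coalgHom_distrib (toConv LinearMap.id)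
    (toConv (scalarMap A ψ) * toConv (twistedAntipode k A q)) (parityCoalgHom k A))
  have h' := congrArg toConv (LinearMap.convMul_comp_coalgHom_distrib (toConv (scalarMap A ψ))
    (toConv (twistedAntipode k A q)) (parityCoalgHom k A))
  rw [WithConv.toConv_ofConv] at h h'
  rw [h'] at h
  have e1 : scalarMap A ψ ∘ₗ (parityCoalgHom k A).toLinearMap = sgn k q • scalarMap A ψ := by
    ext b
    have := LinearMap.congr_fun hψ b
    simp only [LinearMap.comp_apply, LinearMap.smul_apply] at this
    change algebraMap k A (ψ (parity k A b)) = sgn k q • algebraMap k A (ψ b)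
    rw [this, smul_eq_mul, map_mul, Algebra.smul_def]
  have e2 : twistedAntipode k A q ∘ₗ (parityCoalgHom k A).toLinearMap =
      (parityHom k A).toLinearMap ∘ₗ twistedAntipode k A q := by
    ext b
    change antipode (k := k) (parityPow k A q (parity k A b)) = parity k A (antipode (k := k) _)
    rw [parityPow_parity, antipode_parity]
    rfl
  have e3 : LinearMap.id ∘ₗ (parityCoalgHom k A).toLinearMap = (parityHom k A).toLinearMap := rfl
  have h2 := comp_conjFunctional (parityHom k A) ψ q
  change toConv ((conjFunctional k A ψ q).ofConv ∘ₗ (parityCoalgHom k A).toLinearMap) =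
    toConv (LinearMap.id ∘ₗ (parityCoalgHom k A).toLinearMap) *
      (toConv (scalarMap A ψ ∘ₗ (parityCoalgHom k A).toLinearMap) *
        toConv (twistedAntipode k A q ∘ₗ (parityCoalgHom k A).toLinearMap)) at h
  rw [e1, e2, e3, WithConv.toConv_smul, smul_mul_assoc, mul_smul_comm, ← h2] at h
  exact LinearMap.congr_fun (congrArg ofConv h) a

theorem comulHom_twistedAntipode (q : ZMod 2) :
    toConv ((comulHom k A).toLinearMap ∘ₗ twistedAntipode k A q) =
      toConv ((inr k A A).toLinearMap ∘ₗ twistedAntipode k A q) *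
        toConv ((inl k A A).toLinearMap ∘ₗ twistedAntipode k A q) := by
  rcases zmod_two_cases q with rfl | rfl
  · exact comulHom_antipode
  · have h := congrArg toConv (LinearMap.convMul_comp_coalgHom_distrib
      (toConv ((inr k A A).toLinearMap ∘ₗ antipode (k := k)))
      (toConv ((inl k A A).toLinearMap ∘ₗ antipode (k := k))) (parityCoalgHom k A))
    rw [← comulHom_antipode] at h
    exact h

theorem mulRight_conv {C : Type v} [AddCommGroup C] [Module k C] [Coalgebra k C] {R : Type v}
    [Ring R] [Algebra k R] (c : R) (f g : C →ₗ[k] R) (hc : ∀ a, c * g a = g a * c) :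
    toConv (LinearMap.mulRight k c ∘ₗ f) * toConv g =
      toConv (LinearMap.mulRight k c ∘ₗ (toConv f * toConv g).ofConv) := by
  have h : LinearMap.mul' k R ∘ₗ TensorProduct.map (LinearMap.mulRight k c ∘ₗ f) g =
      LinearMap.mulRight k c ∘ₗ LinearMap.mul' k R ∘ₗ TensorProduct.map f g :=
    TensorProduct.ext' fun a b => by simp [mul_assoc, hc]
  ext a
  exact LinearMap.congr_fun h (comul (R := k) a)

theorem conv_mulRight {C : Type v} [AddCommGroup C] [Module k C] [Coalgebra k C] {R : Type v}
    [Ring R] [Algebra k R] (c : R) (f g : C →ₗ[k] R) :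
    toConv f * toConv (LinearMap.mulRight k c ∘ₗ g) =
      toConv (LinearMap.mulRight k c ∘ₗ (toConv f * toConv g).ofConv) := by
  have h : LinearMap.mul' k R ∘ₗ TensorProduct.map f (LinearMap.mulRight k c ∘ₗ g) =
      LinearMap.mulRight k c ∘ₗ LinearMap.mul' k R ∘ₗ TensorProduct.map f g :=
    TensorProduct.ext' fun a b => by simp [mul_assoc]
  ext a
  exact LinearMap.congr_fun h (comul (R := k) a)

/-- If conjugation rescales a functional by `χ`, then `χ` is group-like. -/
theorem comul_of_conjFunctional_eq {ψ : Module.Dual k A} {χ a₀ : A} (hχ : χ ∈ gr k A 0)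
    (ha₀ : ψ a₀ = 1) (h : ∀ a, (conjFunctional k A ψ q).ofConv a = ψ a • χ) :
    comul (R := k) χ = χ ⊗ₜ[k] χ := by
  have hcomp {R : Type v} [Ring R] [Algebra k R] (F : A →ₐ[k] R) :
      F.toLinearMap ∘ₗ (conjFunctional k A ψ q).ofConv =
        LinearMap.mulRight k (F χ) ∘ₗ scalarMap R ψ := by
    ext a
    simp [h, scalarMap_apply, Algebra.smul_def]
  -- Evenness of `χ` is what lets the inner scalar pass the outer conjugating point without a sign.
  have hc (a : A) : inr k A A χ * inl k A A a = inl k A A a * inr k A A χ := by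
    rw [inr_mul_inl', inl_mul_inr, proj_of_mem hχ, proj_of_mem_ne hχ (by decide)]
    simp
  have h1 := comp_conjFunctional (comulHom k A) ψ q
  have hr := comp_conjFunctional (inr k A A) ψ q
  have hl := comp_conjFunctional (inl k A A) ψ q
  rw [hcomp] at hr hl
  -- With `g = inl` and `h = inr` this is `(g h) ψ (g h)⁻¹ = g (h ψ h⁻¹) g⁻¹`; the two conjugations
  -- contribute `inr χ` and `inl χ` in turn.
  have h2 : toConv ((comulHom k A).toLinearMap ∘ₗ (conjFunctional k A ψ q).ofConv) =
      toConv (inl k A A).toLinearMap * ((toConv (inr k A A).toLinearMap *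
        (toConv (scalarMap _ ψ) * toConv ((inr k A A).toLinearMap ∘ₗ twistedAntipode k A q))) *
        toConv ((inl k A A).toLinearMap ∘ₗ twistedAntipode k A q)) := by
    rw [h1, comulHom_eq, comulHom_twistedAntipode]
    simp only [mul_assoc]
  have h3 := conv_mulRight (inr k A A χ) (inl k A A).toLinearMap
    (toConv (scalarMap _ ψ) * toConv ((inl k A A).toLinearMap ∘ₗ twistedAntipode k A q)).ofConv
  rw [← hr, mulRight_conv _ _ _ (fun a => hc _), h3, WithConv.toConv_ofConv, ← hl, hcomp] at h2
  have h4 := LinearMap.congr_fun (congrArg ofConv h2) a₀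
  simp only [LinearMap.comp_apply, LinearMap.mulRight_apply, scalarMap_apply, ha₀,
    map_one, one_mul] at h4
  rw [inl_mul_inr] at h4
  exact (ofT k A A).injective h4

end Conjugation

/-! ### The character on integrals and its restriction -/

section Characters

open WithConv

variable {k : Type u} [Field k]
variable {A : Type v} [Ring A] [Algebra k A] [HopfSuperalgebra k A]
variable {B : Type v} [Ring B] [Algebra k B]

/-- The parity automorphism in the dual coaction fixes the even element `χ`, so it can be dropped.
-/
theorem dualCoaction_eq_iff [FiniteDimensional k B] {δ : B →ₗ[k] A ⊗[k] B} {χ : A}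
    (hχ : χ ∈ gr k A 0) (φ : Module.Dual k B) :
    dualCoaction δ φ = φ ⊗ₜ[k] χ ↔ ∀ b, rslice A φ (δ b) = φ b • χ := by
  have hp : parity k A χ = χ := by rw [parity_of_mem hχ, sgn_zero, one_smul]
  rw [dualCoaction, LinearEquiv.symm_apply_eq, LinearMap.ext_iff]
  refine forall_congr' fun b => ?_
  have e : dualTensorHomEquiv k B A (φ ⊗ₜ[k] χ) b = φ b • χ := by simp
  rw [e]
  change parity k A (rslice A φ (δ b)) = _ ↔ _
  constructor
  · intro h
    rw [← parity_parity (k := k) (rslice A φ (δ b)), h, map_smul, hp]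
  · intro h
    rw [h, map_smul, hp]

variable [HopfSuperalgebra k B]
variable {π : A →ₐ[k] B} {δ : B →ₗ[k] A ⊗[k] B} {φ : Module.Dual k B} {Λ : B}

/-- The character by which a supergroup acts on the left integrals of a normal super-subgroup. -/
theorem exists_character [NeZero (2 : k)] [FiniteDimensional k B] (hA : IsSupercommutative k A)
    (hπ : IsHopfSuperHom π) (hsurj : Function.Surjective π) (hN : IsNormal π)
    (hδ : IsInducedCoad π δ) (hφ : φ ∈ leftIntegrals k B) (h1 : φ Λ = 1)
    (hu : ∀ f ∈ leftIntegrals k B, f = f Λ • φ) :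
    ∃ χ : A, IsGroupLike k χ ∧ ∀ b, rslice A φ (δ b) = φ b • χ := by
  obtain ⟨q, hq⟩ := exists_sgn_of_unique hφ h1 hu
  have hχ (b : B) : rslice A φ (δ b) = φ b • rslice A φ (δ Λ) := by
    refine eq_of_forall_dual (k := k) fun f => ?_
    have h := hu _ (comp_rslice_mem_leftIntegrals hA hπ hsurj hN hδ hφ hq f)
    have h' := LinearMap.congr_fun h b
    simp only [LinearMap.comp_apply, LinearMap.smul_apply, smul_eq_mul] at h'
    rw [h', map_smul, smul_eq_mul, mul_comm]
  obtain ⟨a₀, ha₀⟩ := hsurj Λ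
  have hT (a : A) := rslice_inducedCoad hδ hπ.isSuperHom hq a
  have hψ : (φ ∘ₗ π.toLinearMap) ∘ₗ parity k A = sgn k q • (φ ∘ₗ π.toLinearMap) := by
    ext b
    simpa [hπ.isSuperHom.parity] using LinearMap.congr_fun hq (π b)
  have heven : rslice A φ (δ Λ) ∈ gr k A 0 := by
    have h := parity_conjFunctional hψ a₀
    have hq' := LinearMap.congr_fun hq Λ
    simp only [LinearMap.comp_apply, LinearMap.smul_apply, h1, smul_eq_mul, mul_one] at hq'
    rw [← hT, ← hT, hπ.isSuperHom.parity, ha₀, hχ (parity k B Λ), hq'] at h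
    rw [mem_gr_iff, sgn_zero, one_smul]
    exact (sgn_smul_cancel h).symm
  refine ⟨rslice A φ (δ Λ), ⟨?_, heven, ?_⟩, hχ⟩
  -- Conjugating by the identity point does nothing, so `ε(χ) = φ Λ = 1`.
  · intro h0
    have h := counit_conjFunctional (φ ∘ₗ π.toLinearMap) q a₀
    rw [← hT, ha₀, h0, map_zero, LinearMap.comp_apply, AlgHom.toLinearMap_apply, ha₀, h1] at h
    exact zero_ne_one h
  · refine comul_of_conjFunctional_eq (ψ := φ ∘ₗ π.toLinearMap) (q := q) (a₀ := a₀) heven ?_ ?_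
    · rw [LinearMap.comp_apply, AlgHom.toLinearMap_apply, ha₀, h1]
    · intro a
      rw [← hT, hχ]
      rfl

/-- The restriction of the character on left integrals is inverse to the distinguished
group-like element. -/
theorem map_character_eq [NeZero (2 : k)] (hπ : IsHopfSuperHom π)
    (hsurj : Function.Surjective π) (hδ : IsInducedCoad π δ) (hφ : φ ∈ leftIntegrals k B)
    (h1 : φ Λ = 1) {q : ZMod 2} (hq : φ ∘ₗ parity k B = sgn k q • φ) {χ : A} {d : B}
    (hχ : ∀ b, rslice A φ (δ b) = φ b • χ) (hd : d ∈ gr k B 0)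
    (hφd : ∀ b, lslice B φ (comul (R := k) b) = φ b • d) :
    π χ = antipode (k := k) d := by
  obtain ⟨a, ha⟩ := hsurj Λ
  let πc : A →ₗc[k] B :=
    { toLinearMap := π.toLinearMap
      counit_comp := LinearMap.ext hπ.map_counit
      map_comp_comul := LinearMap.ext fun a => (hπ.map_comul a).symm }
  have h2 := comp_conjFunctional π (φ ∘ₗ π.toLinearMap) q
  have e1 : π.toLinearMap ∘ₗ twistedAntipode k A q =
      twistedAntipode k B q ∘ₗ πc.toLinearMap := by
    ext b
    change π (antipode (k := k) (parityPow k A q b)) = antipode (k := k) (parityPow k B q (π b))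
    rw [hπ.map_antipode, map_parityPow hπ.isSuperHom]
  -- Restricted to `N`, the left conjugating factor is a point of `N` and disappears by invariance.
  -- What remains, `φ g⁻¹`, is the antipode of a slice by `φ`; the parity twist does not affect the
  -- even element `d`.
  have e2 := conv_scalarMap_of_leftIntegral hπ hφ (AlgHom.id k B)
  rw [AlgHom.id_comp] at e2
  have e3 := congrArg toConv (LinearMap.convMul_comp_coalgHom_distrib (toConv (scalarMap B φ))
    (toConv (twistedAntipode k B q)) πc)
  have e4 : LinearMap.mul' k B ∘ₗ TensorProduct.map (scalarMap B φ) (twistedAntipode k B q) =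
      twistedAntipode k B q ∘ₗ lslice B φ :=
    TensorProduct.ext' fun b c => by simp [scalarMap_apply, ← Algebra.smul_def]
  rw [← mul_assoc, e2, e1] at h2
  have h3 := LinearMap.congr_fun (congrArg ofConv (h2.trans e3.symm)) a
  have h4 := LinearMap.congr_fun e4 (comul (R := k) (π a))
  have h5 : π ((conjFunctional k A (φ ∘ₗ π.toLinearMap) q).ofConv a) =
      twistedAntipode k B q (lslice B φ (comul (R := k) (π a))) := h3.trans h4
  rw [← rslice_inducedCoad hδ hπ.isSuperHom hq, hχ, hφd, ha, h1, one_smul, one_smul,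
    twistedAntipode_apply, parityPow_of_even q hd] at h5
  exact h5

end Characters

end SuperHopf

end

/-! ### The main theorem -/

theorem mainTheorem6 {k : Type u} [Field k] (h2 : (2 : k) ≠ 0)
    {A : Type v} [Ring A] [Algebra k A] [HopfSuperalgebra k A]
    (hA : IsSupercommutative k A) [Algebra.FiniteType k A]
    {B : Type v} [Ring B] [Algebra k B] [HopfSuperalgebra k B] [FiniteDimensional k B]
    (π : A →ₐ[k] B) (hπ : IsHopfSuperHom π) (hsurj : Function.Surjective π)
    (hN : IsNormal π) :
    Module.finrank k (leftIntegrals k B) = 1 ∧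
    ∃ δ : B →ₗ[k] A ⊗[k] B, IsInducedCoad π δ ∧
      (∃! χ : A, IsIntegralCharacter δ χ) ∧
      (∃! d : B, IsDistinguishedGroupLike (k := k) d) ∧
      ∀ (χ : A) (d : B), IsIntegralCharacter δ χ → IsDistinguishedGroupLike (k := k) d →
        (π χ * d = 1 ∧ d * π χ = 1) ∧
        (π χ = 1 ↔ IsUnimodular k B) ∧
        (χ = 1 → IsUnimodular k B) := by
  have : NeZero (2 : k) := ⟨h2⟩
  have hB := hA.of_surjective hπ.isSuperHom hsurj
  obtain ⟨φ, Λ, hφ, h1, hu, hr⟩ := exists_leftIntegral (k := k) hB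
  have hφ0 : φ ≠ 0 := by
    rintro rfl
    exact zero_ne_one h1
  obtain ⟨δ, hδ⟩ := hN.exists_inducedCoad hA hB hπ.isSuperHom
  have hchar {χ : A} (hχ : IsIntegralCharacter δ χ) (b : B) :
      rslice A φ (δ b) = φ b • χ := (dualCoaction_eq_iff hχ.1.2.1 φ).1 (hχ.2 φ hφ) b
  have hdist {d : B} (hd : IsDistinguishedGroupLike (k := k) d) (b : B) :
      lslice B φ (CoalgebraStruct.comul (R := k) b) = φ b • d :=
    (forall_dualMul_eq_iff hd.1.2.1).1 (hd.2 φ hφ) b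
  refine ⟨?_, δ, hδ, ?_, ?_, ?_⟩
  · refine finrank_eq_one (⟨φ, hφ⟩ : leftIntegrals k B) (fun h => hφ0 (congrArg Subtype.val h)) ?_
    intro f
    exact ⟨f.1 Λ, Subtype.ext (hu f.1 f.2).symm⟩
  · obtain ⟨χ, hχ, hχφ⟩ := exists_character hA hπ hsurj hN hδ hφ h1 hu
    refine ⟨χ, ⟨hχ, fun f hf => ?_⟩, fun χ' hχ' => ?_⟩
    · rw [dualCoaction_eq_iff hχ.2.1, hu f hf]
      intro b
      rw [rslice_smul, LinearMap.smul_apply, hχφ, LinearMap.smul_apply, smul_assoc]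
    · have h := hchar hχ' Λ
      rw [hχφ, h1, one_smul, one_smul] at h
      exact h.symm
  · obtain ⟨d, hd, hdφ⟩ := exists_groupLike hφ h1 hu
    refine ⟨d, ⟨hd, fun f hf => ?_⟩, fun d' hd' => ?_⟩
    · rw [forall_dualMul_eq_iff hd.2.1, hu f hf]
      intro b
      rw [lslice_smul, LinearMap.smul_apply, hdφ, LinearMap.smul_apply, smul_assoc]
    · have h := hdist hd' Λ
      rw [hdφ, h1, one_smul, one_smul] at h
      exact h.symm
  · intro χ d hχ hd
    obtain ⟨q, hq⟩ := exists_sgn_of_unique hφ h1 hu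
    have hπχ := map_character_eq hπ hsurj hδ hφ h1 hq (hchar hχ) hd.1.2.1 (hdist hd)
    have hinv : π χ * d = 1 ∧ d * π χ = 1 := by
      rw [hπχ]
      exact ⟨hd.1.antipode_mul, hd.1.mul_antipode⟩
    have hiff : π χ = 1 ↔ IsUnimodular k B := by
      constructor
      · intro h
        have hd1 : d = 1 := by rw [← hinv.1, h, one_mul]
        have hle : leftIntegrals k B ≤ rightIntegrals k B := by
          intro f hf g
          rw [hd.2 f hf g, hd1]
        refine ⟨le_antisymm hle fun f hf => ?_, fun h => hφ0 ?_⟩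
        -- With `d = 1`, `φ` is a right integral as well, and the difference is a right integral
        -- vanishing at `Λ`.
        · have h0 : f - f Λ • φ = 0 := by
            refine hr _ (Submodule.sub_mem _ hf (Submodule.smul_mem _ _ (hle hφ))) ?_
            simp [h1]
          rw [sub_eq_zero.1 h0]
          exact Submodule.smul_mem _ _ hφ
        · rw [h] at hφ
          exact hφ
      · intro h
        -- Slicing `Δ(Λ)` by `φ` now gives both `1` and `d`.
        have hφr : φ ∈ rightIntegrals k B := h.1 ▸ hφ
        have h' := hdist hd Λ
        rw [mem_rightIntegrals.1 hφr, h1, one_smul, one_smul] at h'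
        rw [← hinv.1, ← h', mul_one]
    exact ⟨hinv, hiff, fun h => hiff.1 (by rw [h, map_one])⟩
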